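/- Let $n$ be a positive integer, $\boldsymbol x=(x_1,\dots,x_n)$, $\boldsymbol y=(y_1,\dots,y_n)$ formal variables, $\beta,q$ formal parameters, and write $x\oplus y:=x+y+\beta xy$. For $w\in S_n$ let $\ell(w)$ be the number of inversions, let $s_i=(i\;\,i+1)$, $1\le i\le n-1$, let $w_0$ be the longest element, and compose permutations as functions. Let $\partial^x_i f=\frac{f-s_if}{x_i-x_{i+1}}$, where $s_i$ interchanges $x_i$ and $x_{i+1}$, and define $\partial_i^y$ similarly in the variables $\boldsymbol y$. The double dual $(\beta,q)$-Grothendieck polynomials $\mathcal H^{(\beta,q)}_w\in\mathbb C(\beta,q)[\boldsymbol x,\boldsymbol y]$ ($w\in S_n$) are defined by $$\mathcal H^{(\beta,q)}_{w_0}=(1-q^2)^n\prod_{i+j<n+1}(x_i\oplus y_j)\prod_{i+j>n+1}\bigl(1-q^2(1+\beta(x_i\oplus y_j))\bigr),$$ and $\mathcal H^{(\beta,q)}_{s_iw}=\tilde\pi_i^{-1}\mathcal H^{(\beta,q)}_w$ whenever $\ell(s_iw)=\ell(w)-1$, where $\tilde\pi_i=\frac1{\beta^2q^2}\bigl(\partial_i^y(1+\beta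 y_{i+1})-q^2(1+\beta y_{i+1})\partial_i^y\bigr)$, an invertible operator with inverse $(1+\beta y_i)\partial_i^y-q^2\partial_i^y(1+\beta y_i)$. The Lascoux–Schützenberger dual double $\beta$-Grothendieck polynomials $\mathcal H^{(\beta)}_w\in\mathbb C[\beta][\boldsymbol x,\boldsymbol y]$ are defined by $\mathcal H^{(\beta)}_{w_0}=\prod_{i+j<n+1}(x_i\oplus y_j)$ and $\mathcal H^{(\beta)}_{ws_i}=(1+\beta x_i)\,\partial_i^x\,\mathcal H^{(\beta)}_w$ whenever $\ell(ws_i)=\ell(w)-1$. For $v,w\in S_n$ let $\mathfrak S_{v,w}(\boldsymbol x,\boldsymbol y)$ be the following lattice model on the $n\times n$ grid (rows numbered from top to bottom, columns from left to right). Edges carry labels in $\{1<2<\dots<n<+\}$; the right and bottom boundary edges are labelled $+$, the top boundary edges are labelled $v(1),\dots,v(n)$ from left to right, and the left boundary edges are labelled $w(1),\dots,w(n)$ from top to bottom. The vertex in row $i$ and column $j$ with (left, top, right, bottom) labels as follows has the given weight, where $c$ is any label, $a<b$ are any labels, and $z=x_i\oplus y_j$: $$(c,c,c,c):\ 1-q^2(1+\beta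 z),\quad (b,a,b,a):\ z,\quad (a,b,a,b):\ \beta^2q^2z,\quad (b,b,a,a):\ (1-q^2)(1+\beta z),\quad (a,a,b,b):\ 1-q^2,$$ and weight $0$ for all other labels. The partition function $Z(\mathfrak S_{v,w}(\boldsymbol x,\boldsymbol y))$ is the sum, over all labellings of the interior edges, of the product of the weights of the vertices; $Z(\mathfrak S_{v,w}(\boldsymbol y,\boldsymbol x))$ is the same with $\boldsymbol x$ and $\boldsymbol y$ interchanged in the weights. **Theorem.** Both recursions are consistent, so that the two families are well defined (each recursion has exactly one solution), and for every $w\in S_n$ the coefficients of $\mathcal H^{(\beta,q)}_w$ lie in $\mathbb C[\beta,q]$ and $$\mathcal H^{(\beta,q)}_w(\boldsymbol x;\boldsymbol y)\big|_{q=0}=\mathcal H^{(\beta)}_w(\boldsymbol x;\boldsymbol y).$$ Moreover, for every $w\in S_n$, $$Z\bigl(\mathfrak S_{w_0w^{-1},w_0}(\boldsymbol x,\boldsymbol y)\bigr)\big|_{q=0}=\mathcal H^{(\beta)}_w(\boldsymbol x;\boldsymbol y)=Z\bigl(\mathfrak S_{w_0w,w_0}(\boldsymbol y,\boldsymbol x)\bigr)\big|_{q=0}.$$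 -/

import Mathlib

open scoped Polynomial

namespace Grothendieck

/-! ### The symmetric group -/

/-- The length of a permutation `w` of `{0, …, n-1}`: its number of inversions. -/
def length {n : ℕ} (w : Equiv.Perm (Fin n)) : ℕ :=
  (Finset.univ.filter fun p : Fin n × Fin n => p.1 < p.2 ∧ w p.2 < w p.1).card

/-- The longest element `w₀` of `Sₙ`. -/
def longest (n : ℕ) : Equiv.Perm (Fin n) := Fin.revPerm

/-- The index `i` (counted from `0`) as an element of `Fin n`, when `i + 1 < n`. -/
def lo {n : ℕ} (i : ℕ) (hi : i + 1 < n) : Fin n := ⟨i, Nat.lt_of_succ_lt hi⟩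

/-- The index `i + 1` as an element of `Fin n`, when `i + 1 < n`. -/
def hi {n : ℕ} (i : ℕ) (hi : i + 1 < n) : Fin n := ⟨i + 1, hi⟩

/-- The simple reflection exchanging the adjacent indices `i` and `i + 1`. -/
def simple {n : ℕ} (i : ℕ) (h : i + 1 < n) : Equiv.Perm (Fin n) := Equiv.swap (lo i h) (hi i h)

theorem lo_ne_hi {n : ℕ} (i : ℕ) (h : i + 1 < n) : lo i h ≠ hi i h := by
  simp [lo, hi]

/-! ### Divided differences -/

section DividedDifference

variable {σ R : Type*} [DecidableEq σ] [CommRing R]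

/-- The polynomial `f` with the variables `a` and `b` interchanged. -/
noncomputable def swapVars (a b : σ) : MvPolynomial σ R →ₐ[R] MvPolynomial σ R :=
  MvPolynomial.rename (Equiv.swap a b)

theorem dvd_sub_swapVars (a b : σ) (f : MvPolynomial σ R) :
    (MvPolynomial.X a - MvPolynomial.X b : MvPolynomial σ R) ∣ f - swapVars a b f := by
  induction f using MvPolynomial.induction_on with
  | C r => simp [swapVars]
  | add p q hp hq =>
    have : p + q - swapVars a b (p + q) = (p - swapVars a b p) + (q - swapVars a b q) := by
      rw [map_add]; ring
    rw [this]; exact dvd_add hp hq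
  | mul_X p c hp =>
    have hX : (MvPolynomial.X a - MvPolynomial.X b : MvPolynomial σ R) ∣
        MvPolynomial.X c - swapVars a b (MvPolynomial.X c) := by
      simp only [swapVars, MvPolynomial.rename_X]
      rcases eq_or_ne c a with rfl | hca
      · simp
      · rcases eq_or_ne c b with rfl | hcb
        · rw [Equiv.swap_apply_right]; exact ⟨-1, by ring⟩
        · simp [Equiv.swap_apply_of_ne_of_ne hca hcb]
    have : p * MvPolynomial.X c - swapVars a b (p * MvPolynomial.X c) =
        (p - swapVars a b p) * MvPolynomial.X c +
          swapVars a b p * (MvPolynomial.X c - swapVars a b (MvPolynomial.X c)) := by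
      rw [map_mul]; ring
    rw [this]
    exact dvd_add (Dvd.dvd.mul_right hp _) (Dvd.dvd.mul_left hX _)

/-- Newton's divided difference `∂ f = (f - s f) / (X a - X b)`, where `s` interchanges the distinct
variables `a` and `b`; the division is exact in the polynomial ring. -/
noncomputable def divDiff (a b : σ) (f : MvPolynomial σ R) : MvPolynomial σ R :=
  (dvd_sub_swapVars a b f).choose

theorem divDiff_spec (a b : σ) (f : MvPolynomial σ R) :
    (MvPolynomial.X a - MvPolynomial.X b) * divDiff a b f = f - swapVars a b f :=
  (dvd_sub_swapVars a b f).choose_spec.symm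

end DividedDifference

/-! ### The operators `π̃` and their inverses -/

section Operators

variable {σ K : Type*} [DecidableEq σ] [Field K]

/-- `(1 / (β² q²)) (∂ (1 + β X_b) - q² (1 + β X_b) ∂)` for the pair of variables `(a, b)`. -/
noncomputable def piTilde (β q : K) (a b : σ) (f : MvPolynomial σ K) : MvPolynomial σ K :=
  MvPolynomial.C (1 / (β ^ 2 * q ^ 2)) *
    (divDiff a b ((1 + MvPolynomial.C β * MvPolynomial.X b) * f) -
      MvPolynomial.C (q ^ 2) * ((1 + MvPolynomial.C β * MvPolynomial.X b) * divDiff a b f))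

/-- `(1 + β X_a) ∂ - q² ∂ (1 + β X_a)` for the pair of variables `(a, b)`. -/
noncomputable def piTildeInv (β q : K) (a b : σ) (f : MvPolynomial σ K) : MvPolynomial σ K :=
  (1 + MvPolynomial.C β * MvPolynomial.X a) * divDiff a b f -
    MvPolynomial.C (q ^ 2) * divDiff a b ((1 + MvPolynomial.C β * MvPolynomial.X a) * f)

theorem X_sub_X_ne_zero {a b : σ} (hab : a ≠ b) :
    (MvPolynomial.X a - MvPolynomial.X b : MvPolynomial σ K) ≠ 0 :=
  sub_ne_zero.2 fun h => hab (MvPolynomial.X_injective h)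

/-- A divided difference is determined by its defining equation. -/
theorem divDiff_eq {a b : σ} (hab : a ≠ b) {f g : MvPolynomial σ K}
    (h : (MvPolynomial.X a - MvPolynomial.X b) * g = f - swapVars a b f) : divDiff a b f = g :=
  mul_left_cancel₀ (X_sub_X_ne_zero hab) ((divDiff_spec a b f).trans h.symm)

theorem swapVars_swapVars (a b : σ) (f : MvPolynomial σ K) :
    swapVars a b (swapVars a b f) = f := by
  simp only [swapVars, MvPolynomial.rename_rename]
  have : (⇑(Equiv.swap a b) ∘ ⇑(Equiv.swap a b)) = id := by ext; simp
  rw [this, MvPolynomial.rename_id]; rfl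

theorem swapVars_divDiff {a b : σ} (hab : a ≠ b) (f : MvPolynomial σ K) :
    swapVars a b (divDiff a b f) = divDiff a b f := by
  symm
  apply divDiff_eq hab
  have h := congrArg (swapVars a b) (divDiff_spec a b f)
  simp only [map_mul, map_sub, swapVars_swapVars] at h
  have h1 : swapVars a b (MvPolynomial.X a : MvPolynomial σ K) = MvPolynomial.X b := by
    simp [swapVars]
  have h2 : swapVars a b (MvPolynomial.X b : MvPolynomial σ K) = MvPolynomial.X a := by
    simp [swapVars]
  rw [h1, h2] at h
  linear_combination -h

/-- The Leibniz rule for `∂`. -/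
theorem divDiff_mul {a b : σ} (hab : a ≠ b) (f g : MvPolynomial σ K) :
    divDiff a b (f * g) = divDiff a b f * g + swapVars a b f * divDiff a b g := by
  apply divDiff_eq hab
  rw [map_mul]
  linear_combination g * divDiff_spec a b f + swapVars a b f * divDiff_spec a b g

theorem divDiff_sub {a b : σ} (hab : a ≠ b) (f g : MvPolynomial σ K) :
    divDiff a b (f - g) = divDiff a b f - divDiff a b g := by
  apply divDiff_eq hab
  rw [map_sub]
  linear_combination divDiff_spec a b f - divDiff_spec a b g

theorem divDiff_C_mul {a b : σ} (hab : a ≠ b) (r : K) (f : MvPolynomial σ K) :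
    divDiff a b (MvPolynomial.C r * f) = MvPolynomial.C r * divDiff a b f := by
  apply divDiff_eq hab
  have : swapVars a b (MvPolynomial.C r : MvPolynomial σ K) = MvPolynomial.C r := by
    simp [swapVars]
  rw [map_mul, this]
  linear_combination MvPolynomial.C r * divDiff_spec a b f

theorem divDiff_divDiff {a b : σ} (hab : a ≠ b) (f : MvPolynomial σ K) :
    divDiff a b (divDiff a b f) = 0 :=
  divDiff_eq hab (by rw [swapVars_divDiff hab]; ring)

theorem divDiff_mul_left {a b : σ} (hab : a ≠ b) (β : K) (f : MvPolynomial σ K) :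
    divDiff a b ((1 + MvPolynomial.C β * MvPolynomial.X a) * f) =
      MvPolynomial.C β * f + (1 + MvPolynomial.C β * MvPolynomial.X b) * divDiff a b f := by
  have hs : swapVars a b (1 + MvPolynomial.C β * MvPolynomial.X a : MvPolynomial σ K) =
      1 + MvPolynomial.C β * MvPolynomial.X b := by simp [swapVars]
  have hd : divDiff a b (1 + MvPolynomial.C β * MvPolynomial.X a : MvPolynomial σ K) =
      MvPolynomial.C β := divDiff_eq hab (by rw [hs]; ring)
  rw [divDiff_mul hab, hs, hd]

theorem divDiff_mul_right {a b : σ} (hab : a ≠ b) (β : K) (f : MvPolynomial σ K) :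
    divDiff a b ((1 + MvPolynomial.C β * MvPolynomial.X b) * f) =
      (1 + MvPolynomial.C β * MvPolynomial.X a) * divDiff a b f - MvPolynomial.C β * f := by
  have hs : swapVars a b (1 + MvPolynomial.C β * MvPolynomial.X b : MvPolynomial σ K) =
      1 + MvPolynomial.C β * MvPolynomial.X a := by simp [swapVars]
  have hd : divDiff a b (1 + MvPolynomial.C β * MvPolynomial.X b : MvPolynomial σ K) =
      -MvPolynomial.C β := divDiff_eq hab (by rw [hs]; ring)
  rw [divDiff_mul hab, hs, hd]; ring

theorem C_one_div_mul {β q : K} (hβ : β ≠ 0) (hq : q ≠ 0) :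
    (MvPolynomial.C (1 / (β ^ 2 * q ^ 2)) * (MvPolynomial.C (q ^ 2) * MvPolynomial.C β ^ 2) :
      MvPolynomial σ K) = 1 := by
  rw [← MvPolynomial.C_pow, ← MvPolynomial.C_mul, ← MvPolynomial.C_mul, ← MvPolynomial.C_1]
  congr 1
  field_simp

theorem divDiff_piTildeInv {a b : σ} (hab : a ≠ b) (β q : K) (f : MvPolynomial σ K) :
    divDiff a b (piTildeInv β q a b f) = MvPolynomial.C β * divDiff a b f := by
  unfold piTildeInv
  rw [divDiff_sub hab, divDiff_mul_left hab, divDiff_C_mul hab, divDiff_divDiff hab,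
    divDiff_divDiff hab]
  ring

theorem divDiff_piTilde {a b : σ} (hab : a ≠ b) (β q : K) (f : MvPolynomial σ K) :
    divDiff a b (piTilde β q a b f) = MvPolynomial.C (1 / (β ^ 2 * q ^ 2)) *
      (MvPolynomial.C (q ^ 2) * MvPolynomial.C β * divDiff a b f) := by
  unfold piTilde
  rw [divDiff_C_mul hab, divDiff_sub hab, divDiff_divDiff hab, divDiff_C_mul hab,
    divDiff_mul_right hab, divDiff_divDiff hab]
  ring

/-- The operator `π̃` is invertible, with the explicit inverse above. -/
noncomputable def piTildeEquiv {β q : K} (hβ : β ≠ 0) (hq : q ≠ 0) {a b : σ} (hab : a ≠ b) :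
    MvPolynomial σ K ≃ MvPolynomial σ K where
  toFun := piTilde β q a b
  invFun := piTildeInv β q a b
  left_inv f := by
    have h1 := divDiff_piTilde hab β q f
    have hc := C_one_div_mul (σ := σ) hβ hq
    unfold piTildeInv
    rw [divDiff_mul_left hab, h1]
    unfold piTilde
    rw [divDiff_mul_right hab]
    linear_combination f * hc
  right_inv f := by
    have h1 := divDiff_piTildeInv hab β q f
    have hc := C_one_div_mul (σ := σ) hβ hq
    unfold piTilde
    rw [divDiff_mul_right hab, h1]
    unfold piTildeInv
    rw [divDiff_mul_left hab]
    linear_combination f * hc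

end Operators

/-! ### The chromatic lattice model -/

section Lattice

variable {R : Type*} [CommRing R]

/-- The formal group law `x ⊕ y = x + y + β x y`. -/
def oplus (β x y : R) : R := x + y + β * x * y

/-- Edge labels: the colors `0 < 1 < … < n-1`, and `+`, which is `⊤` and larger than any color. -/
abbrev Label (n : ℕ) : Type := WithTop (Fin n)

/-- The Boltzmann weight of a vertex with parameters `x`, `y` whose adjacent edges carry the labels
`l` (left), `t` (top), `r` (right), `b` (bottom); inadmissible vertices have weight `0`. -/
def weight {n : ℕ} (β q x y : R) (l t r b : Label n) : R :=
  if l = t ∧ t = r ∧ r = b then 1 - q ^ 2 * (1 + β * oplus β x y)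
  else if l = r ∧ t = b then
    if t < l then oplus β x y else β ^ 2 * q ^ 2 * oplus β x y
  else if l = t ∧ r = b then
    if r < l then (1 - q ^ 2) * (1 + β * oplus β x y) else 1 - q ^ 2
  else 0

/-- A labelling of all edges of the `n × n` grid: `s.1 i j` is the label of the horizontal edge in
row `i` to the left of column `j` (for `j = n`: at the right boundary), and `s.2 i j` is the label
of the vertical edge in column `j` above row `i` (for `i = n`: at the bottom boundary). Rows are
numbered from top to bottom and columns from left to right. -/
abbrev Labelling (n : ℕ) : Type :=
  (Fin n → Fin (n + 1) → Label n) × (Fin (n + 1) → Fin n → Label n)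

/-- The boundary conditions of the system `𝔖_{v,w}`: the top boundary carries
`v(1), …, v(n)` from left to right, the left boundary carries `w(1), …, w(n)` from top to bottom,
and the right and bottom boundaries carry `+`. -/
def IsState {n : ℕ} (v w : Equiv.Perm (Fin n)) (s : Labelling n) : Prop :=
  (∀ j, s.2 0 j = ((v j : Fin n) : Label n)) ∧ (∀ i, s.1 i 0 = ((w i : Fin n) : Label n)) ∧
    (∀ i, s.1 i (Fin.last n) = ⊤) ∧ ∀ j, s.2 (Fin.last n) j = ⊤

/-- The Boltzmann weight of a labelling: the product of the weights of all vertices. -/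
def boltzmann {n : ℕ} (β q : R) (x y : Fin n → R) (s : Labelling n) : R :=
  ∏ i : Fin n, ∏ j : Fin n,
    weight β q (x i) (y j) (s.1 i j.castSucc) (s.2 i.castSucc j) (s.1 i j.succ) (s.2 i.succ j)

open scoped Classical in
/-- The partition function `Z(𝔖_{v,w}(x, y))` of the chromatic model with parameters `β`, `q`. -/
noncomputable def partitionFunction {n : ℕ} (β q : R) (x y : Fin n → R)
    (v w : Equiv.Perm (Fin n)) : R :=
  ∑ s ∈ (Finset.univ : Finset (Labelling n)).filter (IsState v w), boltzmann β q x y s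

end Lattice

/-! ### Dual Grothendieck polynomials -/

/-- `ℂ[β][q]`; the inner variable is `β` and the outer one is `q`. -/
abbrev ParamRing : Type := ℂ[X][X]

/-- `ℂ(β, q)`. -/
abbrev ParamField : Type := FractionRing ParamRing

/-- The parameter `β` in `ℂ(β, q)`. -/
noncomputable def betaK : ParamField := algebraMap ParamRing ParamField (Polynomial.C Polynomial.X)

/-- The parameter `q` in `ℂ(β, q)`. -/
noncomputable def qK : ParamField := algebraMap ParamRing ParamField Polynomial.X

theorem betaK_ne_zero : betaK ≠ 0 := by
  simp [betaK]

theorem qK_ne_zero : qK ≠ 0 := by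
  simp [qK]

/-- The index set of the variables `x₁, …, xₙ` (left summand) and `y₁, …, yₙ` (right summand). -/
abbrev Vars (n : ℕ) : Type := Fin n ⊕ Fin n

/-- The variables `x` of a polynomial ring in `x` and `y`. -/
noncomputable def xVar {n : ℕ} {R : Type*} [CommRing R] (i : Fin n) : MvPolynomial (Vars n) R :=
  MvPolynomial.X (Sum.inl i)

/-- The variables `y` of a polynomial ring in `x` and `y`. -/
noncomputable def yVar {n : ℕ} {R : Type*} [CommRing R] (j : Fin n) : MvPolynomial (Vars n) R :=
  MvPolynomial.X (Sum.inr j)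

/-- `(1 - q²)ⁿ ∏_{i+j<n+1} (xᵢ ⊕ yⱼ) ∏_{i+j>n+1} (1 - q² (1 + β (xᵢ ⊕ yⱼ)))`, where `i`, `j` run over
`1, …, n`; in the code they are shifted by one. -/
noncomputable def topPolynomial (n : ℕ) {R : Type*} [CommRing R] (β q : R) :
    MvPolynomial (Vars n) R :=
  (1 - MvPolynomial.C q ^ 2) ^ n *
    (∏ p : Fin n × Fin n with (p.1 + 1 : ℕ) + (p.2 + 1 : ℕ) < n + 1,
      oplus (MvPolynomial.C β) (xVar p.1) (yVar p.2)) *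
    ∏ p : Fin n × Fin n with n + 1 < (p.1 + 1 : ℕ) + (p.2 + 1 : ℕ),
      (1 - MvPolynomial.C q ^ 2 *
        (1 + MvPolynomial.C β * oplus (MvPolynomial.C β) (xVar p.1) (yVar p.2)))

/-- The operator `π̃ᵢ`, acting on the `y` variables of `ℂ(β, q)[x, y]`, as an invertible map. -/
noncomputable def piTildeY {n : ℕ} (i : ℕ) (h : i + 1 < n) :
    MvPolynomial (Vars n) ParamField ≃ MvPolynomial (Vars n) ParamField :=
  piTildeEquiv betaK_ne_zero qK_ne_zero
    (a := Sum.inr (lo i h)) (b := Sum.inr (hi i h)) fun e => lo_ne_hi i h (Sum.inr_injective e)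

/-- `H` is the family of double dual `(β, q)`-Grothendieck polynomials. -/
structure IsDualBetaQ (n : ℕ)
    (H : Equiv.Perm (Fin n) → MvPolynomial (Vars n) ParamField) : Prop where
  base : H (longest n) = topPolynomial n betaK qK
  step : ∀ (w : Equiv.Perm (Fin n)) (i : ℕ) (h : i + 1 < n),
    length (simple i h * w) + 1 = length w → H (simple i h * w) = (piTildeY i h).symm (H w)

/-- The operator `μᵢ = (1 + β xᵢ) ∂ᵢ`, acting on the `x` variables of `ℂ[β][x, y]`. -/
noncomputable def muX {n : ℕ} (i : ℕ) (h : i + 1 < n) (f : MvPolynomial (Vars n) ℂ[X]) :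
    MvPolynomial (Vars n) ℂ[X] :=
  (1 + MvPolynomial.C Polynomial.X * xVar (lo i h)) *
    divDiff (Sum.inl (lo i h)) (Sum.inl (hi i h)) f

/-- `H` is the family of dual double `β`-Grothendieck polynomials of Lascoux and Schützenberger. The
initial polynomial is the double `β`-Grothendieck polynomial of `w₀`. -/
structure IsDualBeta (n : ℕ)
    (H : Equiv.Perm (Fin n) → MvPolynomial (Vars n) ℂ[X]) : Prop where
  base : H (longest n) = ∏ p : Fin n × Fin n with (p.1 + 1 : ℕ) + (p.2 + 1 : ℕ) < n + 1,
    oplus (MvPolynomial.C Polynomial.X) (xVar p.1) (yVar p.2)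
  step : ∀ (w : Equiv.Perm (Fin n)) (i : ℕ) (h : i + 1 < n),
    length (w * simple i h) + 1 = length w → H (w * simple i h) = muX i h (H w)

/-- `F|_{q=0} = G`: the polynomial `F` over `ℂ(β, q)` has all its coefficients in `ℂ[β, q]`, and
setting `q = 0` in them gives `G`. -/
def SpecializesAtQZero {n : ℕ} (F : MvPolynomial (Vars n) ParamField)
    (G : MvPolynomial (Vars n) ℂ[X]) : Prop :=
  ∃ P : MvPolynomial (Vars n) ParamRing,
    MvPolynomial.map (algebraMap ParamRing ParamField) P = F ∧
      MvPolynomial.map (Polynomial.evalRingHom 0) P = G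

end Grothendieck

namespace Grothendieck

/-! ### Lengths of permutations -/

/-! Both families are partition functions, and everything rests on one exchange relation. The
lattice weights satisfy a Yang–Baxter equation (`yangBaxter`) with an auxiliary vertex that swaps
two adjacent columns. Pushing this vertex down through all rows gives `partitionFunction_exchange`:
exchanging an ascent in the top boundary is a divided-difference operator in the column variables.
In `𝔖_{1,w₀}` a single state has nonzero weight, and its weight is the initial polynomial at `w₀`.

With columns carrying y, the exchange relation is exactly the recursion by `π̃ᵢ⁻¹`, so the functions
with top boundary `w₀w⁻¹` are the (β, q)-family. With columns carrying x and q = 0, it is the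
recursion by `(1 + βxᵢ)∂ᵢ`, so the functions with top boundary `w₀w` are the β-family. Existence of
both families follows without checking braid relations; uniqueness holds because every `w ≠ w₀` has
an ascent.

It remains to compare the two models at q = 0. The first satisfies a left recursion with operators
in y, the second a right recursion with operators in x. These operators commute, and at `w₀` the
x-operator of index i agrees with the y-operator of index n - i (indices from 1), so
`left_recursion_of_right` turns the right recursion into the left one. -/

theorem simple_mul_simple {n : ℕ} (i : ℕ) (h : i + 1 < n) :
    (simple i h : Equiv.Perm (Fin n)) * simple i h = 1 :=
  Equiv.swap_mul_self _ _

theorem simple_lo {n : ℕ} (i : ℕ) (h : i + 1 < n) : simple i h (lo i h) = hi i h :=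
  Equiv.swap_apply_left _ _

theorem simple_hi {n : ℕ} (i : ℕ) (h : i + 1 < n) : simple i h (hi i h) = lo i h :=
  Equiv.swap_apply_right _ _

theorem simple_val {n : ℕ} (i : ℕ) (h : i + 1 < n) (j : Fin n) :
    (simple i h j : ℕ) = if (j : ℕ) = i then i + 1 else if (j : ℕ) = i + 1 then i else j := by
  unfold simple lo hi
  rw [Equiv.swap_apply_def]
  simp only [Fin.ext_iff]
  split_ifs <;> rfl

theorem simple_simple {n : ℕ} (i : ℕ) (h : i + 1 < n) (j : Fin n) :
    simple i h (simple i h j) = j :=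
  by
  rw [← Equiv.Perm.mul_apply, simple_mul_simple, Equiv.Perm.one_apply]

theorem length_inv {n : ℕ} (w : Equiv.Perm (Fin n)) : length w⁻¹ = length w := by
  unfold length
  refine Finset.card_bij' (fun p _ => (w⁻¹ p.2, w⁻¹ p.1)) (fun p _ => (w p.2, w p.1)) ?_ ?_ ?_ ?_
  all_goals simp +contextual

/-- The pair (i, i+1) is the only one whose order `sᵢ` reverses, and it becomes a new inversion.
Applying `sᵢ` to both entries matches the remaining inversions with those of `w`. -/
theorem length_mul_simple {n : ℕ} (w : Equiv.Perm (Fin n)) (i : ℕ) (h : i + 1 < n)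
    (hw : w (lo i h) < w (hi i h)) : length (w * simple i h) = length w + 1 := by
  unfold length
  have hmem : (lo i h, hi i h) ∈ Finset.univ.filter fun p : Fin n × Fin n =>
      p.1 < p.2 ∧ (w * simple i h) p.2 < (w * simple i h) p.1 := by
    rw [Finset.mem_filter]
    refine ⟨Finset.mem_univ _, by simp [lo, hi], ?_⟩
    simpa only [Equiv.Perm.mul_apply, simple_lo, simple_hi] using hw
  rw [← Finset.card_erase_add_one hmem]
  congr 1
  refine Finset.card_bij' (fun p _ => (simple i h p.1, simple i h p.2))
    (fun p _ => (simple i h p.1, simple i h p.2)) ?_ ?_ ?_ ?_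
  · rintro ⟨a, b⟩ hp
    simp only [Finset.mem_erase, Finset.mem_filter, Finset.mem_univ, true_and] at hp ⊢
    simp only [ne_eq, Prod.mk.injEq, Equiv.Perm.mul_apply] at hp ⊢
    refine ⟨?_, hp.2.2⟩
    have h1 := hp.1
    have h2 := hp.2.1
    simp only [lo, hi, Fin.ext_iff] at h1
    rw [Fin.lt_def, simple_val, simple_val]
    rw [Fin.lt_def] at h2
    split_ifs <;> omega
  · rintro ⟨a, b⟩ hp
    simp only [Finset.mem_erase, Finset.mem_filter, Finset.mem_univ, true_and] at hp ⊢
    simp only [ne_eq, Prod.mk.injEq, Equiv.Perm.mul_apply, simple_simple] at hp ⊢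
    have h0 : ¬ (a = lo i h ∧ b = hi i h) := by
      rintro ⟨rfl, rfl⟩
      exact absurd hp.2 (not_lt.2 hw.le)
    have h2 := hp.1
    simp only [lo, hi, Fin.ext_iff] at h0 ⊢
    rw [Fin.lt_def, simple_val, simple_val]
    rw [Fin.lt_def] at h2
    refine ⟨?_, ?_, hp.2⟩ <;> split_ifs <;> omega
  · intro p _; simp [simple_simple]
  · intro p _; simp [simple_simple]

theorem mul_simple_mul_simple {n : ℕ} (w : Equiv.Perm (Fin n)) (i : ℕ) (h : i + 1 < n) :
    w * simple i h * simple i h = w := by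
  rw [mul_assoc, simple_mul_simple, mul_one]

/-- The length goes down under right multiplication by `sᵢ` exactly at the descents `i`. -/
theorem length_mul_simple_of_descent {n : ℕ} (w : Equiv.Perm (Fin n)) (i : ℕ) (h : i + 1 < n)
    (hw : w (hi i h) < w (lo i h)) : length (w * simple i h) + 1 = length w := by
  have := length_mul_simple (w * simple i h) i h (by simpa [simple_lo, simple_hi] using hw)
  rw [mul_simple_mul_simple] at this
  exact this.symm

theorem lt_or_lt_of_simple {n : ℕ} (w : Equiv.Perm (Fin n)) (i : ℕ) (h : i + 1 < n) :
    w (lo i h) < w (hi i h) ∨ w (hi i h) < w (lo i h) :=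
  lt_or_gt_of_ne fun e => lo_ne_hi i h (w.injective e)

theorem descent_of_length_mul_simple {n : ℕ} {w : Equiv.Perm (Fin n)} {i : ℕ} {h : i + 1 < n}
    (hw : length (w * simple i h) + 1 = length w) : w (hi i h) < w (lo i h) := by
  rcases lt_or_lt_of_simple w i h with h1 | h1
  · have := length_mul_simple w i h h1; omega
  · exact h1

theorem simple_inv {n : ℕ} (i : ℕ) (h : i + 1 < n) :
    (simple i h : Equiv.Perm (Fin n))⁻¹ = simple i h :=
  Equiv.swap_inv _ _

theorem length_simple_mul_eq {n : ℕ} (w : Equiv.Perm (Fin n)) (i : ℕ) (h : i + 1 < n) :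
    length (simple i h * w) = length (w⁻¹ * simple i h) := by
  rw [← length_inv, mul_inv_rev, simple_inv]

theorem length_mul_simple_cases {n : ℕ} (w : Equiv.Perm (Fin n)) (i : ℕ) (h : i + 1 < n) :
    length (w * simple i h) = length w + 1 ∨ length (w * simple i h) + 1 = length w :=
  (lt_or_lt_of_simple w i h).imp (length_mul_simple w i h) (length_mul_simple_of_descent w i h)

theorem length_simple_mul_cases {n : ℕ} (w : Equiv.Perm (Fin n)) (i : ℕ) (h : i + 1 < n) :
    length (simple i h * w) = length w + 1 ∨ length (simple i h * w) + 1 = length w := by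
  rw [length_simple_mul_eq, ← length_inv w]
  exact length_mul_simple_cases w⁻¹ i h

/-- If every position is a descent, then `w₀w` is strictly increasing on a finite chain, hence the
identity. -/
theorem exists_ascent {n : ℕ} {w : Equiv.Perm (Fin n)} (hw : w ≠ longest n) :
    ∃ (i : ℕ) (h : i + 1 < n), length (w * simple i h) = length w + 1 := by
  by_contra! hc
  apply hw
  have hd : ∀ i (h : i + 1 < n), w (hi i h) < w (lo i h) := fun i h =>
    (lt_or_lt_of_simple w i h).resolve_left fun h1 => hc i h (length_mul_simple w i h h1)
  have hmono : StrictMono (fun j => longest n (w j)) := by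
    rcases n with _ | n
    · exact fun a => a.elim0
    · rw [Fin.strictMono_iff_lt_succ]
      intro j
      have := hd j (by omega)
      simp only [longest, Fin.revPerm_apply, Fin.rev_lt_rev]
      exact this
  have hid : ∀ j, longest n (w j) = j := by
    intro j
    have := Subsingleton.elim
      (hmono.orderIsoOfSurjective _ ((longest n).surjective.comp w.surjective)) (OrderIso.refl _)
    exact congrArg (fun e : Fin n ≃o Fin n => e j) this
  ext j
  have := congrArg (longest n) (hid j)
  simp only [longest, Fin.revPerm_apply, Fin.rev_rev] at this ⊢
  rw [this]

theorem length_longest_inv {n : ℕ} : (longest n)⁻¹ = longest n := by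
  ext; simp [longest]

theorem length_le {n : ℕ} (w : Equiv.Perm (Fin n)) : length w ≤ n * n := by
  refine (Finset.card_filter_le _ _).trans ?_
  simp

/-- Downward induction on the length of a permutation. -/
theorem length_induction {n : ℕ} {P : Equiv.Perm (Fin n) → Prop}
    (H : ∀ w, (∀ u, length w < length u → P u) → P w) (w : Equiv.Perm (Fin n)) : P w := by
  induction hk : n * n - length w using Nat.strong_induction_on generalizing w with
  | _ k ih =>
    subst hk
    refine H w fun u hu => ih _ ?_ u rfl
    have := length_le u
    omega

/-- A family with prescribed value at `w₀` is determined by its recursion under right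
multiplication. -/
theorem eq_of_right_recursion {n : ℕ} {A : Type*} (T : ∀ i, i + 1 < n → A → A)
    {H H' : Equiv.Perm (Fin n) → A} (h0 : H (longest n) = H' (longest n))
    (h1 : ∀ w i h, length (w * simple i h) + 1 = length w → H (w * simple i h) = T i h (H w))
    (h2 : ∀ w i h, length (w * simple i h) + 1 = length w → H' (w * simple i h) = T i h (H' w)) :
    H = H' := by
  funext w
  induction w using length_induction with
  | H w ih =>
    by_cases hw : w = longest n
    · rw [hw, h0]
    · obtain ⟨i, h, e⟩ := exists_ascent hw
      have e' : length (w * simple i h * simple i h) + 1 = length (w * simple i h) := by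
        rw [mul_simple_mul_simple, e]
      have a1 := h1 _ i h e'
      have a2 := h2 _ i h e'
      rw [mul_simple_mul_simple] at a1 a2
      rw [a1, a2, ih _ (by omega)]

/-- A family with prescribed value at `w₀` is determined by its recursion under left
multiplication. -/
theorem eq_of_left_recursion {n : ℕ} {A : Type*} (T : ∀ i, i + 1 < n → A → A)
    {H H' : Equiv.Perm (Fin n) → A} (h0 : H (longest n) = H' (longest n))
    (h1 : ∀ w i h, length (simple i h * w) + 1 = length w → H (simple i h * w) = T i h (H w))
    (h2 : ∀ w i h, length (simple i h * w) + 1 = length w → H' (simple i h * w) = T i h (H' w)) :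
    H = H' := by
  -- Inversion exchanges left and right multiplication while preserving length and `w₀`.
  have key := eq_of_right_recursion (H := fun w => H w⁻¹) (H' := fun w => H' w⁻¹) T
    (by simpa [length_longest_inv] using h0)
    (fun w i h e => by
      have := h1 w⁻¹ i h (by rw [length_simple_mul_eq, inv_inv, length_inv, e])
      simpa [mul_inv_rev, simple_inv] using this)
    (fun w i h e => by
      have := h2 w⁻¹ i h (by rw [length_simple_mul_eq, inv_inv, length_inv, e])
      simpa [mul_inv_rev, simple_inv] using this)
  funext w
  simpa using congrFun key w⁻¹

/-- Conjugation by `w₀` is the diagram automorphism, which reads i ↦ n - 2 - i when indices start at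
0. -/
theorem simple_mul_longest {n : ℕ} (i : ℕ) (h : i + 1 < n) (h' : n - 2 - i + 1 < n) :
    simple (n - 2 - i) h' * longest n = longest n * simple i h := by
  ext j
  have := j.2
  simp only [Equiv.Perm.mul_apply, longest, Fin.revPerm_apply, simple_val, Fin.val_rev]
  split_ifs <;> omega

/-- If the operators `T` and `T'` commute and agree on the value at `w₀` up to the symmetry of the
Dynkin diagram, a family satisfying the recursion for right multiplication with operators `T`
satisfies the recursion for left multiplication with operators `T'`. -/
theorem left_recursion_of_right {n : ℕ} {A : Type*} (T T' : ∀ i, i + 1 < n → A → A)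
    (hcomm : ∀ i hi j hj a, T i hi (T' j hj a) = T' j hj (T i hi a))
    {H : Equiv.Perm (Fin n) → A}
    (h0 : ∀ i hi j hj, i + j + 2 = n → T i hi (H (longest n)) = T' j hj (H (longest n)))
    (h1 : ∀ w i h, length (w * simple i h) + 1 = length w → H (w * simple i h) = T i h (H w))
    (w : Equiv.Perm (Fin n)) : ∀ j h, length (simple j h * w) + 1 = length w →
      H (simple j h * w) = T' j h (H w) := by
  induction w using length_induction with
  | H w ih =>
    intro j hj e
    by_cases hw : w = longest n
    · subst hw
      have hi : n - 2 - j + 1 < n := by omega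
      have := simple_mul_longest (n - 2 - j) hi (by omega)
      have hj' : n - 2 - (n - 2 - j) = j := by omega
      simp only [hj'] at this
      rw [this] at e ⊢
      rw [h1 _ _ _ e, h0 _ hi j hj (by omega)]
    · obtain ⟨i, hi, a⟩ := exists_ascent hw
      have hd : length (w * simple i hi * simple i hi) + 1 = length (w * simple i hi) := by
        rw [mul_simple_mul_simple, a]
      have hH := h1 _ i hi hd
      rw [mul_simple_mul_simple] at hH
      have hc := length_mul_simple_cases (simple j hj * w) i hi
      rw [mul_assoc] at hc
      have hc' := length_simple_mul_cases (w * simple i hi) j hj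
      -- The lengths of `sⱼw` and `wsᵢ` are ℓ(w) - 1 and ℓ(w) + 1, and `sⱼwsᵢ` differs from each by
      -- one, so its length is ℓ(w). Hence `sⱼw` is reached from `wsᵢ` through `sⱼwsᵢ`, and
      -- commuting the two operators gives the claim.
      have hu : length (simple j hj * (w * simple i hi)) + 1 = length (w * simple i hi) := by
        omega
      have hL := ih _ (by omega) j hj hu
      have hs : simple j hj * (w * simple i hi) * simple i hi = simple j hj * w := by
        rw [mul_assoc, mul_simple_mul_simple]
      have hR := h1 (simple j hj * (w * simple i hi)) i hi (by rw [hs]; omega)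
      rw [hs, hL, hcomm, ← hH] at hR
      exact hR

/-! ### The Yang–Baxter equation -/

section YangBaxter

variable {n : ℕ} {R : Type*} [CommRing R]

/-- The weight of the vertex exchanging two columns with parameters `y`, `u`, when the labels `a`
and `b` stay in place. -/
def stay (β q y u : R) (a b : Label n) : R :=
  if a = b then 1 + β * y - q ^ 2 * (1 + β * u)
  else if a < b then (1 - q ^ 2) * (1 + β * y) else (1 - q ^ 2) * (1 + β * u)

/-- The weight of the vertex exchanging two columns with parameters `y`, `u`, when the labels `a`
and `b` are interchanged. -/
def cross (β q y u : R) (a b : Label n) : R :=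
  if a = b then 0 else if a < b then u - y else β ^ 2 * q ^ 2 * (u - y)

theorem weight_of_ne (β q x y : R) {l t : Label n} (h : l ≠ t) (r b : Label n) :
    weight β q x y l t r b = if r = l ∧ b = t then
      if t < l then oplus β x y else β ^ 2 * q ^ 2 * oplus β x y else 0 := by
  unfold weight
  simp only [h, false_and, if_false]
  congr 1
  simp only [eq_comm]

theorem weight_same (β q x y : R) (l r b : Label n) :
    weight β q x y l l r b = if r = b then
      if l = r then 1 - q ^ 2 * (1 + β * oplus β x y)
      else if r < l then (1 - q ^ 2) * (1 + β * oplus β x y) else 1 - q ^ 2 else 0 := by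
  unfold weight
  by_cases h : r = b
  · subst h
    by_cases h' : l = r
    · simp [h']
    · simp [h']
  · by_cases h' : l = r
    · subst h'; simp [h]
    · simp [h, h']

/-- The left, top and bottom labels leave at most one right label with nonzero weight. Every
internal sum in the Yang–Baxter equation thus collapses to a single term. -/
theorem sum_weight_mul (β q x y : R) (l t b : Label n) (f : Label n → R) :
    ∑ m, weight β q x y l t m b * f m =
      if l = t then weight β q x y l l b b * f b
      else if b = t then weight β q x y l t l t * f l else 0 := by
  split_ifs with h1 h2
  · subst h1
    rw [Finset.sum_eq_single b]
    · intro m _ hm; rw [weight_same, if_neg hm, zero_mul]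
    · simp
  · subst h2
    rw [Finset.sum_eq_single l]
    · intro m _ hm; rw [weight_of_ne _ _ _ _ h1, if_neg (fun h => hm h.1), zero_mul]
    · simp
  · refine Finset.sum_eq_zero fun m _ => ?_
    rw [weight_of_ne _ _ _ _ h1, if_neg (fun h => h2 h.2), zero_mul]


theorem yangBaxter_of_eq (β q x y u : R) (a r b₁ b₂ : Label n) :
    stay β q y u a a * ∑ m, weight β q x y a a m b₁ * weight β q x u m a r b₂ +
      cross β q y u a a * ∑ m, weight β q x y a a m b₁ * weight β q x u m a r b₂ =
    (∑ m, weight β q x u a a m b₁ * weight β q x y m a r b₂) * stay β q y u b₁ b₂ +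
      (∑ m, weight β q x u a a m b₂ * weight β q x y m a r b₁) * cross β q y u b₂ b₁ := by
  simp only [sum_weight_mul, if_true]
  by_cases h1 : b₁ = a
  · subst h1
    by_cases hr : r = b₂
    · subst hr
      rcases lt_trichotomy r b₁ with h | rfl | h
      · simp [weight, stay, cross, oplus, h, h.ne, h.ne', not_lt_of_gt h]
        ring
      · simp [weight, stay, cross, oplus]
        ring
      · simp [weight, stay, cross, oplus, h, h.ne, h.ne', not_lt_of_gt h]
        ring
    · have hr' := Ne.symm hr
      by_cases h2 : b₂ = b₁
      · subst h2
        simp [weight, stay, cross, hr, hr']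
      · have h2' := Ne.symm h2
        simp [weight, stay, cross, hr, hr', h2, h2']
  · have h1' := Ne.symm h1
    by_cases h2 : b₂ = a
    · subst h2
      by_cases hr : r = b₁
      · subst hr
        rcases lt_or_gt_of_ne h1 with h | h
        · simp [weight, stay, cross, oplus, h, h.ne, h.ne', not_lt_of_gt h]
          ring
        · simp [weight, stay, cross, oplus, h, h.ne, h.ne', not_lt_of_gt h]
          ring
      · have hr' := Ne.symm hr
        simp [weight, stay, cross, hr, hr', h1, h1']
    · simp [weight_of_ne _ _ _ _ h1, weight_of_ne _ _ _ _ h2, h1, h2]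

set_option maxHeartbeats 1000000 in
theorem yangBaxter_of_eq_left (β q x y u : R) {a c : Label n} (hac : a ≠ c) (r b₁ b₂ : Label n) :
    stay β q y u a c * ∑ m, weight β q x y a a m b₁ * weight β q x u m c r b₂ +
      cross β q y u a c * ∑ m, weight β q x y a c m b₁ * weight β q x u m a r b₂ =
    (∑ m, weight β q x u a a m b₁ * weight β q x y m c r b₂) * stay β q y u b₁ b₂ +
      (∑ m, weight β q x u a a m b₂ * weight β q x y m c r b₁) * cross β q y u b₂ b₁ := by
  have hca := hac.symm
  simp only [sum_weight_mul, if_true, hac, if_false]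
  by_cases h1 : b₁ = c
  · subst h1
    by_cases hr : r = b₂
    · subst hr
      -- Weights depend only on the relative order of the labels. Contradictory orderings are
      -- discarded by `order`; each consistent one is a polynomial identity.
      rcases lt_or_gt_of_ne hac with h | h <;> rcases lt_trichotomy r a with h' | rfl | h' <;>
        rcases lt_trichotomy r b₁ with h'' | rfl | h'' <;>
        first
        | (exfalso; order)
        | (simp [weight, stay, cross, oplus, LT.lt.ne, LT.lt.ne', not_lt_of_gt, *] <;> ring)
    · have hr' := Ne.symm hr
      by_cases h2 : b₂ = b₁
      · subst h2
        simp [weight_same, hr]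
      · simp [weight_same, weight_of_ne _ _ _ _ h2, hr]
  · have h1' := Ne.symm h1
    by_cases h2 : b₂ = c
    · subst h2
      by_cases hr : r = b₁
      · subst hr
        rcases lt_or_gt_of_ne hac with h | h <;> rcases lt_trichotomy r a with h' | rfl | h' <;>
          rcases lt_or_gt_of_ne h1 with h'' | h'' <;>
          first
          | (exfalso; order)
          | (simp [weight, stay, cross, oplus, LT.lt.ne, LT.lt.ne', not_lt_of_gt, *] <;> ring)
      · have hr' := Ne.symm hr
        simp [weight_same, weight_of_ne _ _ _ _ h1, hr, h1]
    · simp [weight_of_ne _ _ _ _ h1, weight_of_ne _ _ _ _ h2, h1, h2]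

set_option maxHeartbeats 1000000 in
theorem yangBaxter_of_eq_right (β q x y u : R) {a c : Label n} (hac : a ≠ c) (r b₁ b₂ : Label n) :
    stay β q y u c a * ∑ m, weight β q x y a c m b₁ * weight β q x u m a r b₂ +
      cross β q y u c a * ∑ m, weight β q x y a a m b₁ * weight β q x u m c r b₂ =
    (∑ m, weight β q x u a c m b₁ * weight β q x y m a r b₂) * stay β q y u b₁ b₂ +
      (∑ m, weight β q x u a c m b₂ * weight β q x y m a r b₁) * cross β q y u b₂ b₁ := by
  have hca := hac.symm
  simp only [sum_weight_mul, if_true, hac, if_false]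
  by_cases h1 : b₁ = c
  · subst h1
    by_cases hr : r = b₂
    · subst hr
      rcases lt_or_gt_of_ne hac with h | h <;> rcases lt_trichotomy r a with h' | rfl | h' <;>
        rcases lt_trichotomy r b₁ with h'' | rfl | h'' <;>
        first
        | (exfalso; order)
        | (simp [weight, stay, cross, oplus, LT.lt.ne, LT.lt.ne', not_lt_of_gt, *] <;> ring)
    · have hr' := Ne.symm hr
      by_cases h2 : b₂ = b₁
      · subst h2
        simp [weight_same, hr]
      · simp [weight_same, hr, h2]
  · have h1' := Ne.symm h1
    by_cases h2 : b₂ = c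
    · subst h2
      by_cases hr : r = b₁
      · subst hr
        rcases lt_or_gt_of_ne hac with h | h <;> rcases lt_trichotomy r a with h' | rfl | h' <;>
          rcases lt_or_gt_of_ne h1 with h'' | h'' <;>
          first
          | (exfalso; order)
          | (simp [weight, stay, cross, oplus, LT.lt.ne, LT.lt.ne', not_lt_of_gt, *] <;> ring)
      · have hr' := Ne.symm hr
        simp [weight_same, weight_of_ne _ _ _ _ h1, hr, h1]
    · simp [weight_of_ne _ _ _ _ h1, h1, h2]

/-- Pushing the column-exchanging vertex from above a row to below it interchanges the parameters
`y` and `u`. Since internal labels are forced, comparing `l` with `t₁` and `t₂` and then ordering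
the labels leaves finitely many identities. -/
theorem yangBaxter (β q x y u : R) (l r t₁ t₂ b₁ b₂ : Label n) :
    stay β q y u t₁ t₂ * ∑ m, weight β q x y l t₁ m b₁ * weight β q x u m t₂ r b₂ +
      cross β q y u t₁ t₂ * ∑ m, weight β q x y l t₂ m b₁ * weight β q x u m t₁ r b₂ =
    (∑ m, weight β q x u l t₁ m b₁ * weight β q x y m t₂ r b₂) * stay β q y u b₁ b₂ +
      (∑ m, weight β q x u l t₁ m b₂ * weight β q x y m t₂ r b₁) * cross β q y u b₂ b₁ := by
  by_cases h1 : l = t₁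
  · subst h1
    by_cases h2 : l = t₂
    · subst h2
      exact yangBaxter_of_eq β q x y u l r b₁ b₂
    · exact yangBaxter_of_eq_left β q x y u h2 r b₁ b₂
  · by_cases h2 : l = t₂
    · subst h2
      exact yangBaxter_of_eq_right β q x y u h1 r b₁ b₂
    -- Here `l` meets neither top label, so it runs straight through both vertices, and the bottom
    -- labels are the top ones, in either order.
    · simp only [sum_weight_mul, h1, h2, if_false]
      simp only [weight_of_ne _ _ _ _ h1, weight_of_ne _ _ _ _ h2]
      by_cases h3 : t₁ = t₂
      · subst h3
        by_cases hb1 : b₁ = t₁ <;> by_cases hb2 : b₂ = t₁ <;> by_cases hr : r = l <;>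
          simp [stay, cross, *] <;> split_ifs <;> ring
      · have h3' := Ne.symm h3
        by_cases hb1 : b₁ = t₁
        · subst hb1
          by_cases hb2 : b₂ = t₂
          · subst hb2
            by_cases hr : r = l
            · rcases lt_or_gt_of_ne h3 with h | h <;>
                simp [stay, cross, oplus, h, h.ne, h.ne', not_lt_of_gt h, hr] <;>
                split_ifs <;> ring
            · simp [h3, h3', hr]
          · by_cases hb3 : b₂ = b₁ <;> simp [h3, h3', hb2, hb3]
        · by_cases hb2 : b₁ = t₂
          · subst hb2
            by_cases hb3 : b₂ = t₁
            · subst hb3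
              by_cases hr : r = l
              · rcases lt_or_gt_of_ne h3 with h | h <;>
                  simp [stay, cross, oplus, h, h.ne, h.ne', not_lt_of_gt h, hr] <;>
                  split_ifs <;> ring
              · simp [h3, h3', hr]
            · simp [h3', hb3]
          · simp [hb1, hb2]

end YangBaxter

/-! ### Transfer matrices -/

/-- A product of matrices as a sum over paths. -/
theorem prod_ofFn_apply {α R : Type*} [Fintype α] [DecidableEq α] [CommRing R] {k : ℕ}
    (M : Fin k → Matrix α α R) (a b : α) :
    (List.ofFn M).prod a b = ∑ p : Fin (k + 1) → α,
      if p 0 = a ∧ p (Fin.last k) = b then ∏ j, M j (p j.castSucc) (p j.succ) else 0 := by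
  induction k generalizing a with
  | zero =>
    rw [List.ofFn_zero, List.prod_nil, Matrix.one_apply,
      ← (Equiv.funUnique (Fin 1) α).symm.sum_comp]
    simp only [Fin.last_zero, Equiv.funUnique_symm_apply, uniqueElim_const, Finset.univ_eq_empty,
      Finset.prod_empty]
    split_ifs with h
    · subst h; simp
    · symm; apply Finset.sum_eq_zero
      rintro c -
      rw [if_neg]
      rintro ⟨rfl, h'⟩
      exact h h'
  | succ k ih =>
    rw [List.ofFn_succ, List.prod_cons, Matrix.mul_apply,
      ← (Fin.consEquiv fun _ : Fin (k + 2) => α).sum_comp, Fintype.sum_prod_type]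
    simp only [Fin.consEquiv, Equiv.coe_fn_mk, Fin.cons_zero]
    symm
    rw [Finset.sum_eq_single a]
    · simp only [ih, Finset.mul_sum]
      conv_rhs => rw [Finset.sum_comm]
      refine Finset.sum_congr rfl fun p _ => ?_
      rw [Finset.sum_eq_single (p 0)]
      · simp only [true_and, ← Fin.succ_last, Fin.cons_succ, Fin.prod_univ_succ, Fin.castSucc_zero,
          Fin.cons_zero, ← Fin.succ_castSucc, mul_ite, mul_zero]
      · intro c _ hc
        rw [if_neg fun h => hc h.1.symm, mul_zero]
      · simp
    · intro c _ hc
      simp [hc]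
    · simp

/-- A product of the values of a finite sequence, as a function of two adjacent factors. -/
theorem exists_prod_ofFn_split {A : Type*} [Monoid A] {n : ℕ} (i : ℕ) (h : i + 1 < n) :
    ∀ f : Fin n → A, ∃ P S : A, ∀ g : Fin n → A, (∀ j, j ≠ lo i h → j ≠ hi i h → g j = f j) →
      (List.ofFn g).prod = P * (g (lo i h) * g (hi i h)) * S := by
  induction i generalizing n with
  | zero =>
    obtain ⟨m, rfl⟩ : ∃ m, n = m + 2 := ⟨n - 2, by omega⟩
    intro f
    refine ⟨1, (List.ofFn fun j : Fin m => f j.succ.succ).prod, fun g hg => ?_⟩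
    rw [List.ofFn_succ, List.ofFn_succ, List.prod_cons, List.prod_cons, one_mul, mul_assoc]
    congr 4
    funext j
    exact hg _ (by simp [lo, Fin.ext_iff]) (by simp [hi, Fin.ext_iff])
  | succ i ih =>
    obtain ⟨m, rfl⟩ : ∃ m, n = m + 1 := ⟨n - 1, by omega⟩
    intro f
    obtain ⟨P, S, hPS⟩ := ih (by omega : i + 1 < m) (fun j => f j.succ)
    refine ⟨f 0 * P, S, fun g hg => ?_⟩
    rw [List.ofFn_succ, List.prod_cons, hPS (fun j => g j.succ) fun j h1 h2 => hg _ ?_ ?_,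
      hg 0 (by simp [lo, Fin.ext_iff]) (by simp [hi, Fin.ext_iff])]
    · simp only [mul_assoc]; rfl
    · simpa [lo, Fin.ext_iff] using h1
    · simpa [hi, Fin.ext_iff] using h2

section Transfer

variable {n : ℕ} {R : Type*} [CommRing R]

/-- The weights of a vertex with prescribed top and bottom labels, as a matrix in the left and right
labels. -/
def vertexMatrix (β q x y : R) (t b : Label n) : Matrix (Label n) (Label n) R :=
  Matrix.of fun l r => weight β q x y l t r b

/-- The partition function of a row with top labels `t` and bottom labels `b`, as a matrix in the
left and right labels. -/
def rowMatrix (β q x : R) (y : Fin n → R) (t b : Fin n → Label n) :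
    Matrix (Label n) (Label n) R :=
  (List.ofFn fun j => vertexMatrix β q x (y j) (t j) (b j)).prod

/-- The transfer matrix of a row with left label `l` and right label `+`. -/
def transfer (β q x : R) (y : Fin n → R) (l : Label n) :
    Matrix (Fin n → Label n) (Fin n → Label n) R :=
  Matrix.of fun t b => rowMatrix β q x y t b l ⊤

/-- A path in the product of transfer matrices records the vertical labels, and a path inside each
row matrix records the horizontal ones. Distributing the product over rows recovers the sum over
labellings, with boundary conditions as endpoints. -/
theorem partitionFunction_eq_prod (β q : R) (x y : Fin n → R) (v w : Equiv.Perm (Fin n)) :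
    partitionFunction β q x y v w =
      (List.ofFn fun i => transfer β q (x i) y ((w i : Fin n) : Label n)).prod
        (fun j => ((v j : Fin n) : Label n)) fun _ => ⊤ := by
  classical
  rw [prod_ofFn_apply, partitionFunction, Finset.sum_filter, Fintype.sum_prod_type,
    Finset.sum_comm]
  refine Finset.sum_congr rfl fun p _ => ?_
  simp only [transfer, rowMatrix, prod_ofFn_apply, Matrix.of_apply, vertexMatrix]
  rw [Finset.prod_univ_sum, Fintype.piFinset_univ]
  split_ifs with hp
  · refine Finset.sum_congr rfl fun h _ => ?_
    rw [Finset.prod_ite_zero]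
    have : IsState v w (h, p) ↔
        ∀ i ∈ Finset.univ, h i 0 = ((w i : Fin n) : Label n) ∧ h i (Fin.last n) = ⊤ := by
      simp only [IsState, hp.1, hp.2, Finset.mem_univ, forall_true_left, forall_and]
      simp
    simp only [this]
    split_ifs <;> rfl
  · refine Finset.sum_eq_zero fun h _ => if_neg ?_
    rintro ⟨h1, -, -, h2⟩
    exact hp ⟨funext h1, funext h2⟩

variable (i : ℕ) (h : i + 1 < n)

/-- The column exchange relation for a single row. -/
theorem row_exchange (β q x : R) (y : Fin n → R) (t b : Fin n → Label n) :
    stay β q (y (lo i h)) (y (hi i h)) (t (lo i h)) (t (hi i h)) • rowMatrix β q x y t b +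
      cross β q (y (lo i h)) (y (hi i h)) (t (lo i h)) (t (hi i h)) •
        rowMatrix β q x y (t ∘ simple i h) b =
    stay β q (y (lo i h)) (y (hi i h)) (b (lo i h)) (b (hi i h)) •
        rowMatrix β q x (y ∘ simple i h) t b +
      cross β q (y (lo i h)) (y (hi i h)) (b (hi i h)) (b (lo i h)) •
        rowMatrix β q x (y ∘ simple i h) t (b ∘ simple i h) := by
  -- `P` and `S` collect the columns left and right of the exchanged pair; they are common to all
  -- four terms.
  obtain ⟨P, S, hPS⟩ := exists_prod_ofFn_split i h
    fun j => vertexMatrix β q x (y j) (t j) (b j)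
  have hs : ∀ j, j ≠ lo i h → j ≠ hi i h → simple i h j = j := fun j h1 h2 =>
    Equiv.swap_apply_of_ne_of_ne h1 h2
  unfold rowMatrix
  rw [hPS _ fun j _ _ => rfl, hPS _ fun j h1 h2 => by simp [hs j h1 h2],
    hPS _ fun j h1 h2 => by simp [hs j h1 h2], hPS _ fun j h1 h2 => by simp [hs j h1 h2]]
  have key : stay β q (y (lo i h)) (y (hi i h)) (t (lo i h)) (t (hi i h)) •
        (vertexMatrix β q x (y (lo i h)) (t (lo i h)) (b (lo i h)) *
          vertexMatrix β q x (y (hi i h)) (t (hi i h)) (b (hi i h))) +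
      cross β q (y (lo i h)) (y (hi i h)) (t (lo i h)) (t (hi i h)) •
        (vertexMatrix β q x (y (lo i h)) (t (hi i h)) (b (lo i h)) *
          vertexMatrix β q x (y (hi i h)) (t (lo i h)) (b (hi i h))) =
      stay β q (y (lo i h)) (y (hi i h)) (b (lo i h)) (b (hi i h)) •
        (vertexMatrix β q x (y (hi i h)) (t (lo i h)) (b (lo i h)) *
          vertexMatrix β q x (y (lo i h)) (t (hi i h)) (b (hi i h))) +
      cross β q (y (lo i h)) (y (hi i h)) (b (hi i h)) (b (lo i h)) •
        (vertexMatrix β q x (y (hi i h)) (t (lo i h)) (b (hi i h)) *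
          vertexMatrix β q x (y (lo i h)) (t (hi i h)) (b (lo i h))) := by
    ext l r
    simp only [Matrix.add_apply, Matrix.smul_apply, Matrix.mul_apply, vertexMatrix,
      Matrix.of_apply, smul_eq_mul, yangBaxter β q x (y (lo i h)) (y (hi i h)) l r]
    ring
  have key' := congrArg (fun M => P * M * S) key
  simpa only [mul_add, add_mul, mul_smul_comm, smul_mul_assoc, Function.comp_apply, simple_lo,
    simple_hi] using key'

/-- The column exchange relation for a stack of rows with bottom boundary `+`. -/
theorem stack_exchange (β q : R) (y : Fin n → R) (L : List (R × Label n)) (t : Fin n → Label n) :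
    stay β q (y (lo i h)) (y (hi i h)) (t (lo i h)) (t (hi i h)) *
        (L.map fun p => transfer β q p.1 y p.2).prod t (fun _ => ⊤) +
      cross β q (y (lo i h)) (y (hi i h)) (t (lo i h)) (t (hi i h)) *
        (L.map fun p => transfer β q p.1 y p.2).prod (t ∘ simple i h) (fun _ => ⊤) =
    (1 + β * y (lo i h) - q ^ 2 * (1 + β * y (hi i h))) *
      (L.map fun p => transfer β q p.1 (y ∘ simple i h) p.2).prod t (fun _ => ⊤) := by
  induction L generalizing t with
  | nil =>
    -- With no rows left all labels must be `⊤`. For equal labels `cross` vanishes and `stay` is the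
    -- scalar factor on the right-hand side.
    simp only [List.map_nil, List.prod_nil, Matrix.one_apply]
    by_cases ht : t = fun _ => ⊤
    · subst ht
      have : ((fun _ => ⊤) ∘ simple i h : Fin n → Label n) = fun _ => ⊤ := rfl
      simp [this, stay, cross]
    · have ht' : t ∘ simple i h ≠ fun _ => ⊤ := by
        intro e
        apply ht
        funext j
        have := congrFun e (simple i h j)
        simpa [simple_simple] using this
      simp [ht, ht']
  | cons p L ih =>
    simp only [List.map_cons, List.prod_cons, Matrix.mul_apply]
    rw [Finset.mul_sum, Finset.mul_sum, Finset.mul_sum, ← Finset.sum_add_distrib]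
    have hrow := fun b => congrFun (congrFun (row_exchange i h β q p.1 y t b) p.2) ⊤
    simp only [Matrix.add_apply, Matrix.smul_apply, smul_eq_mul] at hrow
    simp only [← mul_assoc, ← add_mul, transfer, Matrix.of_apply, hrow]
    simp only [add_mul, Finset.sum_add_distrib]
    -- Reindexing the crossed term by `sᵢ` gives both terms the same row factor, so that the
    -- induction hypothesis applies for each `b`.
    rw [← (Equiv.arrowCongr (simple i h) (Equiv.refl (Label n))).sum_comp
      (fun b => cross β q (y (lo i h)) (y (hi i h)) (b (hi i h)) (b (lo i h)) *
        rowMatrix β q p.1 (y ∘ simple i h) t (b ∘ simple i h) p.2 ⊤ * _)]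
    have hc : ∀ b : Fin n → Label n,
        Equiv.arrowCongr (simple i h) (Equiv.refl (Label n)) b = b ∘ simple i h := by
      intro b
      have hsymm : (simple i h : Equiv.Perm (Fin n)).symm = simple i h := Equiv.symm_swap _ _
      funext j
      simp [Equiv.arrowCongr, hsymm]
    have hcc : ∀ b : Fin n → Label n, (b ∘ simple i h) ∘ simple i h = b := by
      intro b; funext j; simp [simple_simple]
    simp only [hc, hcc, Function.comp_apply, simple_lo, simple_hi]
    rw [← Finset.sum_add_distrib]
    refine Finset.sum_congr rfl fun b _ => ?_
    have := ih b
    simp only [transfer] at this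
    linear_combination rowMatrix β q p.1 (y ∘ simple i h) t b p.2 ⊤ * this

/-- The partition functions whose top boundaries differ by exchanging two adjacent labels are
related by a divided difference. -/
theorem partitionFunction_exchange (β q : R) (x y : Fin n → R) (v w : Equiv.Perm (Fin n))
    (hv : v (lo i h) < v (hi i h)) :
    (1 + β * y (lo i h) - q ^ 2 * (1 + β * y (hi i h))) *
        partitionFunction β q x (y ∘ simple i h) v w =
      (1 - q ^ 2) * (1 + β * y (lo i h)) * partitionFunction β q x y v w -
        (y (lo i h) - y (hi i h)) * partitionFunction β q x y (v * simple i h) w := by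
  have key := stack_exchange i h β q y (List.ofFn fun k => (x k, ((w k : Fin n) : Label n)))
    fun j => ((v j : Fin n) : Label n)
  simp only [List.map_ofFn, Function.comp_def] at key
  simp only [partitionFunction_eq_prod, Equiv.Perm.mul_apply, Function.comp_def]
  rw [← key]
  -- The ascent selects the branches `stay` = (1 - q²)(1 + βyᵢ) and `cross` = yᵢ₊₁ - yᵢ.
  have h1 : ((v (lo i h) : Fin n) : Label n) < v (hi i h) := WithTop.coe_lt_coe.2 hv
  simp only [stay, cross, h1, h1.ne, if_true, if_false]
  ring

end Transfer

/-! ### The system with a unique state -/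

section Ground

variable {n : ℕ} {R : Type*} [CommRing R]

/-- The unique admissible state of the system `𝔖_{1,w₀}`. -/
def groundState (n : ℕ) : Labelling n :=
  (fun i j => if (i : ℕ) + j < n then ((Fin.rev i : Fin n) : Label n) else ⊤,
    fun i j => if (i : ℕ) + j < n then (j : Label n) else ⊤)

theorem eq_of_weight_ne_zero {β q x y : R} {l t r b : Label n} (h : weight β q x y l t r b ≠ 0) :
    (l ≠ t → r = l ∧ b = t) ∧ (l = t → r = b) := by
  constructor
  · intro hlt
    rw [weight_of_ne _ _ _ _ hlt] at h
    by_contra hc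
    exact h (if_neg hc)
  · rintro rfl
    rw [weight_same] at h
    by_contra hc
    exact h (if_neg hc)

/-- The color entering on the left runs straight until it meets the same color on top, at the
antidiagonal. Beyond that all top labels are `⊤`, which forces `⊤` backwards from the right
boundary. The row below sees the same pattern with one color fewer. -/
theorem row_unique (i : Fin n) (h : Fin (n + 1) → Label n) (t b : Fin n → Label n)
    (h0 : h 0 = ((Fin.rev i : Fin n) : Label n)) (hlast : h (Fin.last n) = ⊤)
    (ht : ∀ j : Fin n, t j = if (i : ℕ) + j < n then (j : Label n) else ⊤)
    (hv : ∀ j : Fin n, (h j.castSucc ≠ t j → h j.succ = h j.castSucc ∧ b j = t j) ∧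
      (h j.castSucc = t j → h j.succ = b j)) :
    (∀ j, h j = if (i : ℕ) + j < n then ((Fin.rev i : Fin n) : Label n) else ⊤) ∧
      ∀ j : Fin n, b j = if (i : ℕ) + 1 + j < n then (j : Label n) else ⊤ := by
  have hne : ∀ j : Fin n, (i : ℕ) + 1 + j < n → ((Fin.rev i : Fin n) : Label n) ≠ t j := by
    intro j hj
    rw [ht, if_pos (by omega), Ne, WithTop.coe_inj, Fin.ext_iff, Fin.val_rev]
    omega
  have hA : ∀ j : Fin (n + 1), (i : ℕ) + j < n → h j = ((Fin.rev i : Fin n) : Label n) := by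
    intro j
    induction j using Fin.induction with
    | zero => exact fun _ => h0
    | succ j ih =>
      intro hj
      rw [Fin.val_succ] at hj
      have e := ih (by rw [Fin.val_castSucc]; omega)
      rw [((hv j).1 (by rw [e]; exact hne j (by omega))).1, e]
  -- A label other than `⊤` under a top label `⊤` would pass unchanged to the next edge, which is
  -- already known to be `⊤`.
  have hB : ∀ j : Fin (n + 1), n ≤ (i : ℕ) + j → h j = ⊤ := by
    intro j
    induction j using Fin.reverseInduction with
    | last => exact fun _ => hlast
    | cast j ih =>
      intro hj
      rw [Fin.val_castSucc] at hj
      have e := ih (by rw [Fin.val_succ]; omega)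
      have htj : t j = ⊤ := by rw [ht, if_neg (by omega)]
      by_contra hc
      have := ((hv j).1 (by rwa [htj])).1
      exact hc (this ▸ e)
  refine ⟨fun j => ?_, fun j => ?_⟩
  · split_ifs with hj
    · exact hA j hj
    · exact hB j (by omega)
  · split_ifs with hj
    · have e := hA j.castSucc (by rw [Fin.val_castSucc]; omega)
      rw [((hv j).1 (by rw [e]; exact hne j hj)).2, ht, if_pos (by omega)]
    · have e := hB j.succ (by rw [Fin.val_succ]; omega)
      rw [← (hv j).2 ?_, e]
      by_cases hj' : (i : ℕ) + j < n
      · rw [hA j.castSucc (by rwa [Fin.val_castSucc]), ht, if_pos hj', WithTop.coe_inj,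
          Fin.ext_iff, Fin.val_rev]
        omega
      · rw [hB j.castSucc (by rw [Fin.val_castSucc]; omega), ht, if_neg hj']

theorem isState_groundState (n : ℕ) : IsState (1 : Equiv.Perm (Fin n)) (longest n)
    (groundState n) := by
  refine ⟨fun j => ?_, fun i => ?_, fun i => ?_, fun j => ?_⟩ <;> simp [groundState, longest]

theorem eq_groundState {β q : R} {x y : Fin n → R} {s : Labelling n}
    (hs : IsState (1 : Equiv.Perm (Fin n)) (longest n) s) (h0 : boltzmann β q x y s ≠ 0) :
    s = groundState n := by
  have hw : ∀ i j, weight β q (x i) (y j) (s.1 i j.castSucc) (s.2 i.castSucc j) (s.1 i j.succ)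
      (s.2 i.succ j) ≠ 0 := by
    intro i j e
    exact h0 (Finset.prod_eq_zero (Finset.mem_univ i) (Finset.prod_eq_zero (Finset.mem_univ j) e))
  obtain ⟨h1, h2, h3, -⟩ := hs
  have hrow : ∀ i : Fin n,
      (∀ j : Fin n, s.2 i.castSucc j = if (i : ℕ) + j < n then (j : Label n) else ⊤) →
      (∀ j, s.1 i j = if (i : ℕ) + j < n then ((Fin.rev i : Fin n) : Label n) else ⊤) ∧
        ∀ j : Fin n, s.2 i.succ j = if (i : ℕ) + 1 + j < n then (j : Label n) else ⊤ :=
    fun i hi => row_unique i (s.1 i) (s.2 i.castSucc) (s.2 i.succ)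
      (by rw [h2]; simp [longest]) (h3 i) hi fun j => eq_of_weight_ne_zero (hw i j)
  have hcol : ∀ (i : Fin (n + 1)) (j : Fin n),
      s.2 i j = if (i : ℕ) + j < n then (j : Label n) else ⊤ := by
    intro i
    induction i using Fin.induction with
    | zero => intro j; rw [h1]; simp
    | succ i ih => exact (hrow i ih).2
  refine Prod.ext ?_ ?_
  · funext i j
    exact (hrow i (hcol i.castSucc)).1 j
  · funext i j
    exact hcol i j

/-- Above the antidiagonal a larger color crosses a smaller one. On it a color turns and is replaced
by `⊤`, with weight 1 - q². Below it all four labels are `⊤`. -/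
theorem weight_groundState (β q : R) (x y : Fin n → R) (i j : Fin n) :
    weight β q (x i) (y j) ((groundState n).1 i j.castSucc) ((groundState n).2 i.castSucc j)
      ((groundState n).1 i j.succ) ((groundState n).2 i.succ j) =
    (if j = Fin.rev i then 1 - q ^ 2 else 1) *
      (if (i + 1 : ℕ) + (j + 1 : ℕ) < n + 1 then oplus β (x i) (y j) else 1) *
      if n + 1 < (i + 1 : ℕ) + (j + 1 : ℕ) then 1 - q ^ 2 * (1 + β * oplus β (x i) (y j)) else 1 := by
  have hi := i.2
  have hj := j.2
  simp only [groundState, Fin.val_castSucc, Fin.val_succ, Fin.ext_iff, Fin.val_rev]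
  rcases lt_trichotomy ((i : ℕ) + 1 + j) n with h | h | h
  · have hne : ((Fin.rev i : Fin n) : Label n) ≠ (j : Label n) := by
      rw [Ne, WithTop.coe_inj, Fin.ext_iff, Fin.val_rev]; omega
    have hlt : (j : Label n) < ((Fin.rev i : Fin n) : Label n) := by
      rw [WithTop.coe_lt_coe, Fin.lt_def, Fin.val_rev]; omega
    rw [if_pos (by omega), if_pos (by omega), if_pos (by omega), if_pos (by omega),
      if_neg (by omega), if_pos (by omega), if_neg (by omega), weight_of_ne _ _ _ _ hne,
      if_pos ⟨rfl, rfl⟩, if_pos hlt]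
    ring
  · have he : ((Fin.rev i : Fin n) : Label n) = (j : Label n) := by
      rw [WithTop.coe_inj, Fin.ext_iff, Fin.val_rev]; omega
    rw [if_pos (by omega), if_pos (by omega), if_neg (by omega), if_neg (by omega),
      if_pos (by omega), if_neg (by omega), if_neg (by omega), he, weight_same, if_pos rfl,
      if_neg (WithTop.coe_ne_top), if_neg (by simp)]
    ring
  · rw [if_neg (by omega), if_neg (by omega), if_neg (by omega), if_neg (by omega),
      if_neg (by omega), if_neg (by omega), if_pos (by omega), weight_same, if_pos rfl, if_pos rfl]
    ring

theorem partitionFunction_one_longest (β q : R) (x y : Fin n → R) :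
    partitionFunction β q x y 1 (longest n) =
      (1 - q ^ 2) ^ n *
        (∏ p : Fin n × Fin n with (p.1 + 1 : ℕ) + (p.2 + 1 : ℕ) < n + 1,
          oplus β (x p.1) (y p.2)) *
        ∏ p : Fin n × Fin n with n + 1 < (p.1 + 1 : ℕ) + (p.2 + 1 : ℕ),
          (1 - q ^ 2 * (1 + β * oplus β (x p.1) (y p.2))) := by
  classical
  rw [partitionFunction, Finset.sum_eq_single (groundState n)]
  · simp only [boltzmann, weight_groundState, Finset.prod_mul_distrib, Finset.prod_filter,
      Fintype.prod_prod_type]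
    -- Each row contains exactly one antidiagonal cell, which accounts for (1 - q²)ⁿ.
    simp
  · intro s hs hne
    by_contra hc
    exact hne (eq_groundState (Finset.mem_filter.1 hs).2 hc)
  · intro h
    exact absurd (Finset.mem_filter.2 ⟨Finset.mem_univ _, isState_groundState n⟩) h

end Ground

/-! ### Partition functions as polynomials -/

theorem map_weight {n : ℕ} {R S : Type*} [CommRing R] [CommRing S] (f : R →+* S) (β q x y : R)
    (l t r b : Label n) :
    f (weight β q x y l t r b) = weight (f β) (f q) (f x) (f y) l t r b := by
  unfold weight oplus
  split_ifs <;> simp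

/-- Used for exchanging variables, for extending coefficients to ℂ(β, q), and for setting q = 0. -/
theorem map_partitionFunction {n : ℕ} {R S : Type*} [CommRing R] [CommRing S] (f : R →+* S)
    (β q : R) (x y : Fin n → R) (v w : Equiv.Perm (Fin n)) :
    f (partitionFunction β q x y v w) =
      partitionFunction (f β) (f q) (fun i => f (x i)) (fun i => f (y i)) v w := by
  simp only [partitionFunction, boltzmann, map_sum, map_prod, map_weight]

section Polynomials

variable {n : ℕ} {R : Type*} [CommRing R]

theorem swapVars_C {σ : Type*} [DecidableEq σ] (a b : σ) (r : R) :
    swapVars a b (MvPolynomial.C r : MvPolynomial σ R) = MvPolynomial.C r :=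
  MvPolynomial.rename_C _ _

theorem swapVars_X {σ : Type*} [DecidableEq σ] (a b c : σ) :
    swapVars a b (MvPolynomial.X c : MvPolynomial σ R) = MvPolynomial.X (Equiv.swap a b c) :=
  MvPolynomial.rename_X _ _

variable (i : ℕ) (h : i + 1 < n)

theorem swap_inl (j : Fin n) : Equiv.swap (Sum.inl (lo i h) : Vars n) (Sum.inl (hi i h))
    (Sum.inl j) = Sum.inl (simple i h j) := by
  simp only [simple, Equiv.swap_apply_def, Sum.inl.injEq]
  split_ifs <;> rfl

theorem swap_inr (j : Fin n) : Equiv.swap (Sum.inr (lo i h) : Vars n) (Sum.inr (hi i h))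
    (Sum.inr j) = Sum.inr (simple i h j) := by
  simp only [simple, Equiv.swap_apply_def, Sum.inr.injEq]
  split_ifs <;> rfl

theorem swapVars_inl_xVar (j : Fin n) :
    swapVars (Sum.inl (lo i h)) (Sum.inl (hi i h)) (xVar j : MvPolynomial (Vars n) R) =
      xVar (simple i h j) := by
  rw [xVar, swapVars_X, swap_inl, xVar]

theorem swapVars_inr_yVar (j : Fin n) :
    swapVars (Sum.inr (lo i h)) (Sum.inr (hi i h)) (yVar j : MvPolynomial (Vars n) R) =
      yVar (simple i h j) := by
  rw [yVar, swapVars_X, swap_inr, yVar]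

theorem swapVars_inl_yVar (a b j : Fin n) :
    swapVars (Sum.inl a) (Sum.inl b) (yVar j : MvPolynomial (Vars n) R) = yVar j := by
  rw [yVar, swapVars_X, Equiv.swap_apply_of_ne_of_ne (by simp) (by simp)]

theorem swapVars_inr_xVar (a b j : Fin n) :
    swapVars (Sum.inr a) (Sum.inr b) (xVar j : MvPolynomial (Vars n) R) = xVar j := by
  rw [xVar, swapVars_X, Equiv.swap_apply_of_ne_of_ne (by simp) (by simp)]

theorem swapVars_inr_partitionFunction (β q : R) (v w : Equiv.Perm (Fin n)) :
    swapVars (Sum.inr (lo i h)) (Sum.inr (hi i h))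
      (partitionFunction (MvPolynomial.C β) (MvPolynomial.C q) xVar yVar v w) =
    partitionFunction (MvPolynomial.C β) (MvPolynomial.C q) (xVar : Fin n → MvPolynomial (Vars n) R)
      (yVar ∘ simple i h) v w := by
  refine (map_partitionFunction (swapVars (Sum.inr (lo i h)) (Sum.inr (hi i h))).toRingHom
    _ _ _ _ v w).trans ?_
  simp only [AlgHom.toRingHom_eq_coe, RingHom.coe_coe, swapVars_C, swapVars_inr_xVar,
    swapVars_inr_yVar]
  rfl

theorem swapVars_inl_partitionFunction (β q : R) (v w : Equiv.Perm (Fin n)) :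
    swapVars (Sum.inl (lo i h)) (Sum.inl (hi i h))
      (partitionFunction (MvPolynomial.C β) (MvPolynomial.C q) yVar xVar v w) =
    partitionFunction (MvPolynomial.C β) (MvPolynomial.C q) (yVar : Fin n → MvPolynomial (Vars n) R)
      (xVar ∘ simple i h) v w := by
  refine (map_partitionFunction (swapVars (Sum.inl (lo i h)) (Sum.inl (hi i h))).toRingHom
    _ _ _ _ v w).trans ?_
  simp only [AlgHom.toRingHom_eq_coe, RingHom.coe_coe, swapVars_C, swapVars_inl_xVar,
    swapVars_inl_yVar]
  rfl

/-- Since `w₀` reverses the order, a descent of `w` is an ascent of `w₀w`, as the exchange relation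
requires. -/
theorem longest_mul_lt {w : Equiv.Perm (Fin n)}
    (hw : length (w * simple i h) + 1 = length w) :
    (longest n * w) (lo i h) < (longest n * w) (hi i h) := by
  simp only [Equiv.Perm.mul_apply, longest, Fin.revPerm_apply, Fin.rev_lt_rev]
  exact descent_of_length_mul_simple hw

theorem longest_mul_inv_lt {w : Equiv.Perm (Fin n)}
    (hw : length (simple i h * w) + 1 = length w) :
    (longest n * w⁻¹) (lo i h) < (longest n * w⁻¹) (hi i h) :=
  longest_mul_lt i h (by rwa [← length_simple_mul_eq, length_inv])

theorem longest_mul_longest : longest n * longest n = 1 := by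
  ext; simp [longest]

end Polynomials

/-! ### The double dual `(β, q)`-Grothendieck polynomials -/

section BetaQ

/-- Clearing the denominator brings `π̃⁻¹` into the shape of `partitionFunction_exchange`. -/
theorem X_sub_X_mul_piTildeInv {σ K : Type*} [DecidableEq σ] [Field K] {a b : σ} (hab : a ≠ b)
    (β q : K) (f : MvPolynomial σ K) :
    (MvPolynomial.X a - MvPolynomial.X b) * piTildeInv β q a b f =
      (1 - MvPolynomial.C q ^ 2) * (1 + MvPolynomial.C β * MvPolynomial.X a) * f -
        (1 + MvPolynomial.C β * MvPolynomial.X a -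
          MvPolynomial.C q ^ 2 * (1 + MvPolynomial.C β * MvPolynomial.X b)) * swapVars a b f := by
  unfold piTildeInv
  rw [divDiff_mul_left hab, MvPolynomial.C_pow]
  linear_combination (1 + MvPolynomial.C β * MvPolynomial.X a -
    MvPolynomial.C q ^ 2 * (1 + MvPolynomial.C β * MvPolynomial.X b)) * divDiff_spec a b f

/-- Replacing `w` by `sᵢw` multiplies the top boundary `w₀w⁻¹` by `sᵢ` on the right, so the
recursion is the exchange relation of columns i and i+1, divided by yᵢ - yᵢ₊₁. -/
theorem isDualBetaQ_partitionFunction (n : ℕ) :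
    IsDualBetaQ n fun w => partitionFunction (MvPolynomial.C betaK) (MvPolynomial.C qK) xVar yVar
      (longest n * w⁻¹) (longest n) where
  base := by
    rw [mul_inv_cancel, partitionFunction_one_longest, topPolynomial]
  step w i h hw := by
    have hne : (Sum.inr (lo i h) : Vars n) ≠ Sum.inr (hi i h) := fun e =>
      lo_ne_hi i h (Sum.inr_injective e)
    apply mul_left_cancel₀ (X_sub_X_ne_zero (K := ParamField) hne)
    refine Eq.trans ?_ (X_sub_X_mul_piTildeInv hne betaK qK _).symm
    rw [swapVars_inr_partitionFunction]
    have key := partitionFunction_exchange i h (MvPolynomial.C betaK) (MvPolynomial.C qK)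
      (xVar : Fin n → MvPolynomial (Vars n) ParamField) yVar (longest n * w⁻¹) (longest n)
      (longest_mul_inv_lt i h hw)
    rw [mul_inv_rev, simple_inv, ← mul_assoc]
    simp only [yVar] at key ⊢
    linear_combination key

theorem isDualBetaQ_unique {n : ℕ} {H H' : Equiv.Perm (Fin n) → MvPolynomial (Vars n) ParamField}
    (hH : IsDualBetaQ n H) (hH' : IsDualBetaQ n H') : H = H' :=
  eq_of_left_recursion (fun i h f => (piTildeY i h).symm f) (hH.base.trans hH'.base.symm)
    hH.step hH'.step

end BetaQ

/-! ### The dual double `β`-Grothendieck polynomials -/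

section Isobaric

variable {σ R : Type*} [DecidableEq σ] [CommRing R]

/-- The isobaric operator `(1 + β X_a) ∂` for the pair of variables `(a, b)`. -/
noncomputable def isobaric (β : R) (a b : σ) (f : MvPolynomial σ R) : MvPolynomial σ R :=
  (1 + MvPolynomial.C β * MvPolynomial.X a) * divDiff a b f

theorem X_sub_X_mul_isobaric (β : R) (a b : σ) (f : MvPolynomial σ R) :
    (MvPolynomial.X a - MvPolynomial.X b) * isobaric β a b f =
      (1 + MvPolynomial.C β * MvPolynomial.X a) * (f - swapVars a b f) := by
  rw [← divDiff_spec, isobaric]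
  ring

theorem isobaric_eq [IsDomain R] (β : R) {a b : σ} (hab : a ≠ b) {f g : MvPolynomial σ R}
    (h : (MvPolynomial.X a - MvPolynomial.X b) * g =
      (1 + MvPolynomial.C β * MvPolynomial.X a) * (f - swapVars a b f)) :
    isobaric β a b f = g := by
  have h0 : (MvPolynomial.X a - MvPolynomial.X b : MvPolynomial σ R) ≠ 0 :=
    sub_ne_zero.2 fun e => hab (MvPolynomial.X_injective e)
  exact mul_left_cancel₀ h0 ((X_sub_X_mul_isobaric β a b f).trans h.symm)

theorem swapVars_comm {a b c d : σ} (hac : a ≠ c) (had : a ≠ d) (hbc : b ≠ c) (hbd : b ≠ d)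
    (f : MvPolynomial σ R) :
    swapVars a b (swapVars c d f) = swapVars c d (swapVars a b f) := by
  simp only [swapVars, MvPolynomial.rename_rename]
  congr 2
  funext e
  simp only [Function.comp_apply, Equiv.swap_apply_def]
  split_ifs <;> simp_all

theorem X_sub_X_mul_swapVars_isobaric (β : R) {a b c d : σ} (hac : a ≠ c) (had : a ≠ d)
    (hbc : b ≠ c) (hbd : b ≠ d) (f : MvPolynomial σ R) :
    (MvPolynomial.X c - MvPolynomial.X d) * swapVars a b (isobaric β c d f) =
      (1 + MvPolynomial.C β * MvPolynomial.X c) *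
        (swapVars a b f - swapVars a b (swapVars c d f)) := by
  have := congrArg (swapVars a b) (X_sub_X_mul_isobaric β c d f)
  simpa only [map_mul, map_sub, map_add, map_one, swapVars_C, swapVars_X,
    Equiv.swap_apply_of_ne_of_ne hac.symm hbc.symm,
    Equiv.swap_apply_of_ne_of_ne had.symm hbd.symm] using this

/-- After multiplication by both differences of variables, each side is a combination of `f` and its
images under two disjoint, hence commuting, transpositions. -/
theorem isobaric_comm [IsDomain R] (β : R) {a b c d : σ} (hab : a ≠ b) (hcd : c ≠ d) (hac : a ≠ c)
    (had : a ≠ d) (hbc : b ≠ c) (hbd : b ≠ d) (f : MvPolynomial σ R) :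
    isobaric β a b (isobaric β c d f) = isobaric β c d (isobaric β a b f) := by
  have h0 : (MvPolynomial.X c - MvPolynomial.X d : MvPolynomial σ R) ≠ 0 :=
    sub_ne_zero.2 fun e => hcd (MvPolynomial.X_injective e)
  apply isobaric_eq β hab
  apply mul_left_cancel₀ h0
  have e1 := X_sub_X_mul_isobaric β c d (isobaric β a b f)
  have e2 := X_sub_X_mul_isobaric β a b f
  have e3 := X_sub_X_mul_isobaric β c d f
  have e4 := X_sub_X_mul_swapVars_isobaric β hac had hbc hbd f
  have e5 := X_sub_X_mul_swapVars_isobaric β hac.symm hbc.symm had.symm hbd.symm f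
  rw [← swapVars_comm hac had hbc hbd] at e5
  linear_combination (MvPolynomial.X a - MvPolynomial.X b) * e1 +
    (1 + MvPolynomial.C β * MvPolynomial.X c) * (e2 - e5) -
    (1 + MvPolynomial.C β * MvPolynomial.X a) * (e3 - e4)

end Isobaric

section Beta

variable {n : ℕ}

/-- The operator `(1 + β yᵢ) ∂ᵢ`, acting on the `y` variables of `ℂ[β][x, y]`. -/
noncomputable def muY {n : ℕ} (i : ℕ) (h : i + 1 < n) (f : MvPolynomial (Vars n) ℂ[X]) :
    MvPolynomial (Vars n) ℂ[X] :=
  isobaric Polynomial.X (Sum.inr (lo i h)) (Sum.inr (hi i h)) f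

theorem inl_lo_ne_hi (i : ℕ) (h : i + 1 < n) : (Sum.inl (lo i h) : Vars n) ≠ Sum.inl (hi i h) :=
  fun e => lo_ne_hi i h (Sum.inl_injective e)

theorem inr_lo_ne_hi (i : ℕ) (h : i + 1 < n) : (Sum.inr (lo i h) : Vars n) ≠ Sum.inr (hi i h) :=
  fun e => lo_ne_hi i h (Sum.inr_injective e)

theorem muX_muY (i : ℕ) (hi : i + 1 < n) (j : ℕ) (hj : j + 1 < n)
    (f : MvPolynomial (Vars n) ℂ[X]) : muX i hi (muY j hj f) = muY j hj (muX i hi f) :=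
  isobaric_comm _ (inl_lo_ne_hi i hi) (inr_lo_ne_hi j hj) (by simp) (by simp) (by simp) (by simp) f

/-- The product of `xᵢ ⊕ yⱼ` over `i + j < n + 1`, for `i` and `j` counted from `1`. -/
noncomputable def staircase (n : ℕ) : MvPolynomial (Vars n) ℂ[X] :=
  ∏ p : Fin n × Fin n with (p.1 + 1 : ℕ) + (p.2 + 1 : ℕ) < n + 1,
    oplus (MvPolynomial.C Polynomial.X) (xVar p.1) (yVar p.2)

/-- The cell (i, j) is a corner of the staircase: rows i and i+1 differ only in this cell, and so do
columns j and j+1. Removing it leaves a product symmetric in both pairs of variables. -/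
theorem exists_staircase_factor (i : ℕ) (hi : i + 1 < n) (j : ℕ) (hj : j + 1 < n)
    (hij : i + j + 2 = n) : ∃ P : MvPolynomial (Vars n) ℂ[X],
      staircase n = oplus (MvPolynomial.C Polynomial.X) (xVar (lo i hi)) (yVar (lo j hj)) * P ∧
      swapVars (Sum.inl (lo i hi)) (Sum.inl (Grothendieck.hi i hi)) P = P ∧
      swapVars (Sum.inr (lo j hj)) (Sum.inr (Grothendieck.hi j hj)) P = P := by
  refine ⟨∏ p ∈ (Finset.univ.filter fun p : Fin n × Fin n =>
    (p.1 + 1 : ℕ) + (p.2 + 1 : ℕ) < n + 1).erase (lo i hi, lo j hj),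
    oplus (MvPolynomial.C Polynomial.X) (xVar p.1) (yVar p.2), ?_, ?_, ?_⟩
  · rw [staircase]
    have hmem : (lo i hi, lo j hj) ∈ Finset.univ.filter fun p : Fin n × Fin n =>
        (p.1 + 1 : ℕ) + (p.2 + 1 : ℕ) < n + 1 := by
      simp only [lo, Finset.mem_filter, Finset.mem_univ, true_and]
      omega
    rw [← Finset.mul_prod_erase _ _ hmem]
  · rw [map_prod]
    refine Finset.prod_equiv (Equiv.prodCongr (simple i hi) (Equiv.refl _)) ?_ ?_
    · rintro ⟨a, b⟩
      simp only [Finset.mem_erase, Finset.mem_filter, Finset.mem_univ, true_and,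
        Equiv.prodCongr_apply, Prod.map_apply, Equiv.refl_apply, ne_eq, Prod.mk.injEq, Fin.ext_iff,
        simple_val, lo]
      split_ifs <;> omega
    · rintro ⟨a, b⟩ -
      simp only [oplus, map_add, map_mul, swapVars_C, swapVars_inl_xVar, swapVars_inl_yVar,
        Equiv.prodCongr_apply, Prod.map_apply, Equiv.refl_apply]
  · rw [map_prod]
    refine Finset.prod_equiv (Equiv.prodCongr (Equiv.refl _) (simple j hj)) ?_ ?_
    · rintro ⟨a, b⟩
      simp only [Finset.mem_erase, Finset.mem_filter, Finset.mem_univ, true_and,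
        Equiv.prodCongr_apply, Prod.map_apply, Equiv.refl_apply, ne_eq, Prod.mk.injEq, Fin.ext_iff,
        simple_val, lo]
      split_ifs <;> omega
    · rintro ⟨a, b⟩ -
      simp only [oplus, map_add, map_mul, swapVars_C, swapVars_inr_xVar, swapVars_inr_yVar,
        Equiv.prodCongr_apply, Prod.map_apply, Equiv.refl_apply]

/-- Only the corner factor is differentiated: ∂ᵢ of xᵢ ⊕ yⱼ in x is 1 + βyⱼ, and ∂ⱼ in y is 1 + βxᵢ.
Both operators therefore produce (1 + βxᵢ)(1 + βyⱼ) times the symmetric cofactor. -/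
theorem muX_staircase (i : ℕ) (hi : i + 1 < n) (j : ℕ) (hj : j + 1 < n) (hij : i + j + 2 = n) :
    muX i hi (staircase n) = muY j hj (staircase n) := by
  obtain ⟨P, hP, hx, hy⟩ := exists_staircase_factor i hi j hj hij
  have h1 : muX i hi (staircase n) = (1 + MvPolynomial.C Polynomial.X * xVar (lo i hi)) *
      (1 + MvPolynomial.C Polynomial.X * yVar (lo j hj)) * P := by
    refine isobaric_eq _ (inl_lo_ne_hi i hi) ?_
    rw [hP, map_mul, hx]
    simp only [oplus, map_add, map_mul, swapVars_C, swapVars_inl_xVar, swapVars_inl_yVar, simple_lo]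
    simp only [xVar, yVar]
    ring
  have h2 : muY j hj (staircase n) = (1 + MvPolynomial.C Polynomial.X * xVar (lo i hi)) *
      (1 + MvPolynomial.C Polynomial.X * yVar (lo j hj)) * P := by
    refine isobaric_eq _ (inr_lo_ne_hi j hj) ?_
    rw [hP, map_mul, hy]
    simp only [oplus, map_add, map_mul, swapVars_C, swapVars_inr_xVar, swapVars_inr_yVar, simple_lo]
    simp only [xVar, yVar]
    ring
  rw [h1, h2]

theorem partitionFunction_xy_one_longest :
    partitionFunction (MvPolynomial.C Polynomial.X) 0 xVar yVar 1 (longest n) = staircase n := by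
  rw [partitionFunction_one_longest, staircase]
  simp

theorem partitionFunction_yx_one_longest :
    partitionFunction (MvPolynomial.C Polynomial.X) 0 yVar xVar 1 (longest n) = staircase n := by
  rw [partitionFunction_one_longest, staircase]
  simp only [ne_eq, OfNat.ofNat_ne_zero, not_false_eq_true, zero_pow, sub_zero, one_pow, one_mul,
    zero_mul, Finset.prod_const_one, mul_one]
  refine Finset.prod_equiv (Equiv.prodComm _ _) ?_ ?_
  · rintro ⟨a, b⟩
    simp only [Finset.mem_filter, Finset.mem_univ, true_and, Equiv.prodComm_apply, Prod.swap]
    omega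
  · rintro ⟨a, b⟩ -
    simp only [oplus, Equiv.prodComm_apply, Prod.swap]
    ring

/-- At q = 0 the factor 1 + βxᵢ appears on both partition functions of the unexchanged boundary, so
the exchange relation becomes (1 + βxᵢ)∂ᵢ. The columns carry x here, and right multiplication of `w`
acts directly on the top boundary `w₀w`. -/
theorem isDualBeta_partitionFunction (n : ℕ) :
    IsDualBeta n fun w => partitionFunction (MvPolynomial.C Polynomial.X) 0 yVar xVar
      (longest n * w) (longest n) where
  base := by
    rw [longest_mul_longest, partitionFunction_yx_one_longest, staircase]
  step w i h hw := by
    refine (isobaric_eq _ (inl_lo_ne_hi i h) ?_).symm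
    rw [← MvPolynomial.C_0, swapVars_inl_partitionFunction, ← mul_assoc]
    have key := partitionFunction_exchange i h (MvPolynomial.C Polynomial.X) (MvPolynomial.C 0)
      (yVar : Fin n → MvPolynomial (Vars n) ℂ[X]) xVar (longest n * w) (longest n)
      (longest_mul_lt i h hw)
    rw [MvPolynomial.C_0] at key ⊢
    simp only [xVar] at key ⊢
    linear_combination key

theorem partitionFunction_left_step (w : Equiv.Perm (Fin n)) (i : ℕ) (h : i + 1 < n)
    (hw : length (simple i h * w) + 1 = length w) :
    partitionFunction (MvPolynomial.C Polynomial.X) 0 xVar yVar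
        (longest n * (simple i h * w)⁻¹) (longest n) =
      muY i h (partitionFunction (MvPolynomial.C Polynomial.X) 0 xVar yVar
        (longest n * w⁻¹) (longest n)) := by
  refine (isobaric_eq _ (inr_lo_ne_hi i h) ?_).symm
  rw [← MvPolynomial.C_0, swapVars_inr_partitionFunction, mul_inv_rev, simple_inv, ← mul_assoc]
  have key := partitionFunction_exchange i h (MvPolynomial.C Polynomial.X) (MvPolynomial.C 0)
    (xVar : Fin n → MvPolynomial (Vars n) ℂ[X]) yVar (longest n * w⁻¹) (longest n)
    (longest_mul_inv_lt i h hw)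
  rw [MvPolynomial.C_0] at key ⊢
  simp only [yVar] at key ⊢
  linear_combination key

theorem isDualBeta_unique {H H' : Equiv.Perm (Fin n) → MvPolynomial (Vars n) ℂ[X]}
    (hH : IsDualBeta n H) (hH' : IsDualBeta n H') : H = H' :=
  eq_of_right_recursion muX (hH.base.trans hH'.base.symm) hH.step hH'.step

/-- Both sides obey the same left recursion with operators in y: the model by column exchange, `H`
by transferring its right recursion through `muX_muY` and `muX_staircase`. -/
theorem IsDualBeta.eq_partitionFunction {H : Equiv.Perm (Fin n) → MvPolynomial (Vars n) ℂ[X]}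
    (hH : IsDualBeta n H) (w : Equiv.Perm (Fin n)) :
    partitionFunction (MvPolynomial.C Polynomial.X) 0 xVar yVar
      (longest n * w⁻¹) (longest n) = H w := by
  have hbase : H (longest n) = staircase n := hH.base
  refine congrFun (eq_of_left_recursion muY (H := fun w => partitionFunction
    (MvPolynomial.C Polynomial.X) 0 xVar yVar (longest n * w⁻¹) (longest n)) ?_
    partitionFunction_left_step ?_) w
  · rw [mul_inv_cancel, partitionFunction_xy_one_longest, hbase]
  · refine left_recursion_of_right muX muY muX_muY ?_ hH.step
    intro i hi j hj hij
    rw [hbase]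
    exact muX_staircase i hi j hj hij

/-- The weights are polynomial in β and q, so the same partition function over ℂ[β, q] maps to both
sides. -/
theorem specializesAtQZero_partitionFunction (v w : Equiv.Perm (Fin n)) :
    SpecializesAtQZero
      (partitionFunction (MvPolynomial.C betaK) (MvPolynomial.C qK) xVar yVar v w)
      (partitionFunction (MvPolynomial.C Polynomial.X) 0 xVar yVar v w) := by
  refine ⟨partitionFunction (MvPolynomial.C (Polynomial.C Polynomial.X))
    (MvPolynomial.C Polynomial.X) xVar yVar v w, ?_, ?_⟩
  · refine (map_partitionFunction (R := MvPolynomial (Vars n) ParamRing)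
      (S := MvPolynomial (Vars n) ParamField)
      (MvPolynomial.map (algebraMap ParamRing ParamField)) _ _ _ _ v w).trans ?_
    simp only [xVar, yVar, MvPolynomial.map_C, MvPolynomial.map_X]
    rfl
  · refine (map_partitionFunction (R := MvPolynomial (Vars n) ParamRing)
      (S := MvPolynomial (Vars n) ℂ[X])
      (MvPolynomial.map (Polynomial.evalRingHom 0)) _ _ _ _ v w).trans ?_
    simp only [xVar, yVar, MvPolynomial.map_C, MvPolynomial.map_X, Polynomial.coe_evalRingHom,
      Polynomial.eval_C, Polynomial.eval_X, MvPolynomial.C_0]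
    rfl

end Beta

end Grothendieck

theorem mainTheorem2 (n : ℕ) :
    (∃! H : Equiv.Perm (Fin n) →
        MvPolynomial (Grothendieck.Vars n) Grothendieck.ParamField,
      Grothendieck.IsDualBetaQ n H) ∧
    (∃! H : Equiv.Perm (Fin n) → MvPolynomial (Grothendieck.Vars n) (Polynomial ℂ),
      Grothendieck.IsDualBeta n H) ∧
    ∀ (Hq : Equiv.Perm (Fin n) → MvPolynomial (Grothendieck.Vars n) Grothendieck.ParamField)
      (Hb : Equiv.Perm (Fin n) → MvPolynomial (Grothendieck.Vars n) (Polynomial ℂ)),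
      Grothendieck.IsDualBetaQ n Hq → Grothendieck.IsDualBeta n Hb →
      ∀ w : Equiv.Perm (Fin n),
        Grothendieck.SpecializesAtQZero (Hq w) (Hb w) ∧
        Grothendieck.partitionFunction (MvPolynomial.C Polynomial.X) 0
            Grothendieck.xVar Grothendieck.yVar
            (Grothendieck.longest n * w⁻¹) (Grothendieck.longest n) = Hb w ∧
        Hb w = Grothendieck.partitionFunction (MvPolynomial.C Polynomial.X) 0
            Grothendieck.yVar Grothendieck.xVar
            (Grothendieck.longest n * w) (Grothendieck.longest n) := by

  refine ⟨⟨_, Grothendieck.isDualBetaQ_partitionFunction n, fun H hH =>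
      Grothendieck.isDualBetaQ_unique hH (Grothendieck.isDualBetaQ_partitionFunction n)⟩,
    ⟨_, Grothendieck.isDualBeta_partitionFunction n, fun H hH =>
      Grothendieck.isDualBeta_unique hH (Grothendieck.isDualBeta_partitionFunction n)⟩, ?_⟩
  intro Hq Hb hq hb w
  refine ⟨?_, hb.eq_partitionFunction w, congrFun (Grothendieck.isDualBeta_unique hb
    (Grothendieck.isDualBeta_partitionFunction n)) w⟩
  rw [← hb.eq_partitionFunction w,
    Grothendieck.isDualBetaQ_unique hq (Grothendieck.isDualBetaQ_partitionFunction n)]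
  exact Grothendieck.specializesAtQZero_partitionFunction _ _
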